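/- **Setting.** Fix a finite alphabet $\mathbb{A}$; data values are words $d\in\mathbb{A}^*$. Fix a set $\mathrm{Pat}$ of regular expressions over $\mathbb{A}$ (built from words by concatenation, union and star) and a countable set $\mathbb{Q}$ of properties (here: bit strings). *Filters* are $\varphi ::= \pi \mid q \mid \varphi\wedge\varphi\mid\neg\varphi$ with $\pi\in\mathrm{Pat}$, $q\in\mathbb{Q}$. For $d\in\mathbb{A}^*$ and $Q\subseteq\mathbb{Q}$, $(d,Q)\models\pi$ iff $d$ matches $\pi$, $(d,Q)\models q$ iff $q\in Q$, and $\wedge,\neg$ are as usual. *Singleton-membership of filters* is the problem, given $\varphi$, $d$ and $Q$ with $|Q|\le 1$, whether $(d,Q)\models\varphi$. *Trees* are the hereditarily finite multisets $\{d_1:t_1,\dots,d_n:t_n\}$ ($n\ge 0$, $d_i\in\mathbb{A}^*$, $t_i$ trees). A *horizontal automaton* $H$ consists of a finite set $P$ of horizontal states and a finite set of rules $p\xrightarrow{\varphi}p'$ with $p,p'\in P$ and $\varphi$ a filter. For multisets $M$ over $\mathbb{A}^*\times 2^{\mathbb{Q}}$ put $(p,M+\{d:Q\})\to(p',M)$ if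 $(d,Q)\models\varphi$ for some rule $p\xrightarrow{\varphi}p'$. $H$ is *confluent* if the relation obtained from $\to$ by adding $(p,M)\to\bot$ for all $M\neq\emptyset$ such that no step $(p,M)\to(p',M')$ exists is confluent. $M$ satisfies the descriptor $(p,p')\in P^2$ if $(p,M)\to^*(p',\emptyset)$. The support of a descriptor is the least $S\subseteq\mathbb{Q}$ such that satisfaction by $\{d_1:Q_1,\dots,d_n:Q_n\}$ depends only on the $d_i$ and $Q_i\cap S$. An *AUTC* $A$ consists of a confluent horizontal automaton $H$, a horizontal state $p_0$ of $H$, a finite set of states $\mathcal{Q}\subset\mathbb{Q}$, final states $F\subseteq\mathcal{Q}$, and a finite set of rules $(p_0,p')\to q$ with $p'\in P$, $q\in\mathcal{Q}$, where $(p_0,p')$ has support included in $\mathcal{Q}$, such that $A$ is *vertically deterministic*: the set $$[\![\{d_1:t_1,\dots,d_n:t_n\}]\!]_A=\bigl\{q : \{d_1:[\![t_1]\!]_A,\dots,d_n:[\![t_n]\!]_A\}\text{ satisfies }(p_0,p')\text{ for some rule }(p_0,p')\to q\bigr\}$$ has at most one element for every tree. Its language is $L(A)=\{t : [\![t]\!]_A\cap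 F\neq\emptyset\}$. **Proposition (AUTC membership).** If singleton-membership of filters is decidable in polynomial time, then there is a polynomial-time algorithm which, given any AUTC $A$ and any tree $t$ (both part of the input), decides whether $t\in L(A)$. Here polynomial time means: by a multi-stack Turing machine in a number of steps polynomial in the length of a standard string encoding of the input; a tree is given by any expression denoting it, and the membership algorithm is required to work on those inputs whose automaton is an AUTC. -/

import Mathlib

namespace UTA

/-! ## Data values, patterns and filters -/

/-- Regular expressions over the alphabet `α`; the atoms are words. -/
inductive Pattern (α : Type) : Type where
  | word (d : List α)
  | comp (π ρ : Pattern α)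
  | plus (π ρ : Pattern α)
  | star (π : Pattern α)

/-- The set of data values matched by a pattern. -/
def Pattern.lang {α : Type} : Pattern α → Language α
  | .word d => {d}
  | .comp π ρ => π.lang * ρ.lang
  | .plus π ρ => π.lang + ρ.lang
  | .star π => KStar.kstar π.lang

/-- The fixed countable set of properties (vertical states): bit strings. -/
abbrev Property : Type := List Bool

/-- Names of horizontal states: bit strings. -/
abbrev HState : Type := List Bool

/-- A data value together with a set of properties. -/
abbrev Item (α : Type) : Type := List α × Set Property

/-- Filters `φ ::= π | q | φ ∧ φ | ¬ φ` where `π` ranges over the class `Pat` of patterns. -/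
inductive EdgeFilter {α : Type} (Pat : Set (Pattern α)) : Type where
  | pat (π : Pat)
  | prop (q : Property)
  | conj (φ ψ : EdgeFilter Pat)
  | neg (φ : EdgeFilter Pat)

/-- `φ.Sat (d, Q)` means `(d, Q) ⊨ φ`. -/
def EdgeFilter.Sat {α : Type} {Pat : Set (Pattern α)} : EdgeFilter Pat → Item α → Prop
  | .pat π, x => x.1 ∈ π.1.lang
  | .prop q, x => q ∈ x.2
  | .conj φ ψ, x => φ.Sat x ∧ ψ.Sat x
  | .neg φ, x => ¬ φ.Sat x

/-! ## Unordered data trees -/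

/-- Written expressions for trees: `empty` is `⦃⦄`, and `add d t s` is `⦃d : t⦄ + s`. -/
inductive TreeTerm (α : Type) : Type where
  | empty
  | add (d : List α) (t s : TreeTerm α)

/-- Exchanging two neighbouring edges, anywhere in the expression. -/
inductive TreeTerm.Swap {α : Type} : TreeTerm α → TreeTerm α → Prop where
  | here (d₁ : List α) (t₁ : TreeTerm α) (d₂ : List α) (t₂ s : TreeTerm α) :
      Swap (.add d₁ t₁ (.add d₂ t₂ s)) (.add d₂ t₂ (.add d₁ t₁ s))
  | child (d : List α) {t t' : TreeTerm α} (s : TreeTerm α) :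
      Swap t t' → Swap (.add d t s) (.add d t' s)
  | rest (d : List α) (t : TreeTerm α) {s s' : TreeTerm α} :
      Swap s s' → Swap (.add d t s) (.add d t s')

/-- Unordered, edge-labelled data trees: hereditarily finite multisets `⦃d₁ : t₁, …, dₙ : tₙ⦄`,
that is, expressions up to the equivalence generated by exchanging edges. -/
def Tree (α : Type) : Type := Quot (TreeTerm.Swap (α := α))

/-- The tree denoted by an expression. -/
def TreeTerm.toTree {α : Type} (t : TreeTerm α) : Tree α := Quot.mk _ t

/-! ## Automata for unordered trees -/

/-- A descriptor class for models in `X`. (The size of an object, as an input of an algorithm, is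
the length of its encoding below.) -/
structure DescriptorClass (X : Type) where
  Desc : Type
  Sat : X → Desc → Prop

/-- The subclass of a descriptor class given by a set of descriptors. -/
def DescriptorClass.restrict {X : Type} (D : DescriptorClass X) (S : Set D.Desc) :
    DescriptorClass X where
  Desc := S
  Sat x h := D.Sat x h.1

/-- Horizontal descriptor classes: their models are multisets `⦃d₁ : Q₁, …, dₙ : Qₙ⦄`. -/
abbrev HorizontalClass (α : Type) : Type 1 := DescriptorClass (Multiset (Item α))

/-- Satisfaction of `h` by `⦃d₁ : Q₁, …, dₙ : Qₙ⦄` depends only on the sets `Qᵢ ∩ S`. -/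
def HorizontalClass.DependsOnlyOn {α : Type} (D : HorizontalClass α) (h : D.Desc)
    (S : Set Property) : Prop :=
  ∀ M : Multiset (List α × Set Property × Set Property),
    (∀ x ∈ M, x.2.1 ∩ S = x.2.2 ∩ S) →
      (D.Sat (M.map fun x => (x.1, x.2.1)) h ↔ D.Sat (M.map fun x => (x.1, x.2.2)) h)

/-- The support of a descriptor: the least set of properties on which it depends. -/
def HorizontalClass.support {α : Type} (D : HorizontalClass α) (h : D.Desc) : Set Property :=
  ⋂₀ {S | D.DependsOnlyOn h S}

/-- Alternating bottom-up automata for unordered unranked data trees with horizontal descriptor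
class `D`. The finite sets of states, final states and rules `h → q` are given by lists. -/
structure AUT {α : Type} (D : HorizontalClass α) where
  states : List Property
  final : List Property
  rules : List (D.Desc × Property)
  final_mem : ∀ q ∈ final, q ∈ states
  target_mem : ∀ r ∈ rules, r.2 ∈ states
  support_subset : ∀ r ∈ rules, D.support r.1 ⊆ {q | q ∈ states}

namespace AUT

variable {α : Type} {D : HorizontalClass α}

/-- The right-hand sides `q` of the rules `h → q` with `M ⊨ h`. -/
def targets (A : AUT D) (M : Multiset (Item α)) : Set Property :=
  {q | ∃ h, (h, q) ∈ A.rules ∧ D.Sat M h}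

/-- For `⦃d₁ : t₁, …, dₙ : tₙ⦄`, the multiset `⦃d₁ : ⟦t₁⟧, …, dₙ : ⟦tₙ⟧⦄`, where `⟦t⟧` is the
evaluation of `t`. -/
def annotate (A : AUT D) : TreeTerm α → Multiset (Item α)
  | .empty => 0
  | .add d t s => (d, A.targets (A.annotate t)) ::ₘ A.annotate s

theorem annotate_swap (A : AUT D) {t t' : TreeTerm α} (h : TreeTerm.Swap t t') :
    A.annotate t = A.annotate t' := by
  induction h with
  | here d₁ t₁ d₂ t₂ s => exact Multiset.cons_swap _ _ _
  | child d s _ ih => simp only [annotate, ih]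
  | rest d t _ ih => simp only [annotate, ih]

/-- The set of states to which `A` evaluates a tree. -/
def eval (A : AUT D) : Tree α → Set Property :=
  Quot.lift (fun t => A.targets (A.annotate t)) fun _ _ h => by rw [A.annotate_swap h]

/-- The language accepted by `A`. -/
def language (A : AUT D) : Set (Tree α) :=
  {t | (A.eval t ∩ {q | q ∈ A.final}).Nonempty}

/-- Every tree is evaluated to at most one state. -/
def VerticallyDeterministic (A : AUT D) : Prop :=
  ∀ t : Tree α, (A.eval t).Subsingleton

end AUT

/-! ## Horizontal automata and confluence -/

/-- Horizontal automata; the finite sets of states and rules are given by lists. -/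
structure HAut {α : Type} (Pat : Set (Pattern α)) where
  states : List HState
  rules : List (HState × EdgeFilter Pat × HState)
  rules_mem : ∀ r ∈ rules, r.1 ∈ states ∧ r.2.2 ∈ states

namespace HAut

variable {α : Type} {Pat : Set (Pattern α)}

/-- The horizontal rewriting relation. -/
inductive Rew (H : HAut Pat) :
    HState × Multiset (Item α) → HState × Multiset (Item α) → Prop where
  | read {p p' : HState} {φ : EdgeFilter Pat} {x : Item α} (M : Multiset (Item α)) :
      (p, φ, p') ∈ H.rules → φ.Sat x → Rew H (p, x ::ₘ M) (p', M)

/-- The failure-extended horizontal rewriting relation; `none` is the failure `⊥`. -/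
inductive RewFail (H : HAut Pat) :
    Option (HState × Multiset (Item α)) → Option (HState × Multiset (Item α)) → Prop where
  | step {c c' : HState × Multiset (Item α)} : H.Rew c c' → RewFail H (some c) (some c')
  | fail {p : HState} {M : Multiset (Item α)} :
      M ≠ 0 → (¬ ∃ c', H.Rew (p, M) c') → RewFail H (some (p, M)) none

/-- Confluence of the failure-extended horizontal rewriting relation. -/
def Confluent (H : HAut Pat) : Prop :=
  ∀ a b c, Relation.ReflTransGen H.RewFail a b → Relation.ReflTransGen H.RewFail a c →
    ∃ d, Relation.ReflTransGen H.RewFail b d ∧ Relation.ReflTransGen H.RewFail c d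

/-- The descriptor class of a horizontal automaton: the descriptors are pairs `(p, p')` of
horizontal states, and `M ⊨ (p, p')` if `p'` can be reached from `p` while consuming `M`. -/
def descriptors (H : HAut Pat) : HorizontalClass α where
  Desc := {p // p ∈ H.states} × {p // p ∈ H.states}
  Sat M h := Relation.ReflTransGen H.Rew (h.1.1, M) (h.2.1, 0)

/-- The subclass of the descriptors `(p₀, p')`. -/
def descriptorsFrom (H : HAut Pat) (p₀ : {p // p ∈ H.states}) : HorizontalClass α :=
  DescriptorClass.restrict H.descriptors {h | h.1 = p₀}

end HAut

/-- Vertically deterministic automata with a confluent horizontal automaton `H` and a single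
initial horizontal state `p₀`. -/
structure AUTC {α : Type} (Pat : Set (Pattern α)) where
  H : HAut Pat
  p₀ : {p // p ∈ H.states}
  A : AUT (H.descriptorsFrom p₀)
  confluent : H.Confluent
  deterministic : A.VerticallyDeterministic

/-- The language accepted by an `AUTC`. -/
def AUTC.language {α : Type} {Pat : Set (Pattern α)} (C : AUTC Pat) : Set (Tree α) :=
  C.A.language

/-! ## Encodings as strings over a finite alphabet -/

/-- The letters of the input alphabet of the machines. -/
inductive Tok (α : Type) : Type where
  | letter (a : α)
  | bit (b : Bool)
  | close
  | item
  | word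
  | comp
  | plus
  | star
  | pat
  | prop
  | conj
  | neg

section Encodings

variable {α : Type} {Pat : Set (Pattern α)}

def encodeWord (d : List α) : List (Tok α) := d.map Tok.letter ++ [Tok.close]

def encodeName (q : List Bool) : List (Tok α) := q.map Tok.bit ++ [Tok.close]

def encodeList {β : Type} (e : β → List (Tok α)) : List β → List (Tok α)
  | [] => [Tok.close]
  | x :: xs => Tok.item :: (e x ++ encodeList e xs)

def Pattern.encode : Pattern α → List (Tok α)
  | .word d => Tok.word :: encodeWord d
  | .comp π ρ => Tok.comp :: (π.encode ++ ρ.encode)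
  | .plus π ρ => Tok.plus :: (π.encode ++ ρ.encode)
  | .star π => Tok.star :: π.encode

def EdgeFilter.encode : EdgeFilter Pat → List (Tok α)
  | .pat π => Tok.pat :: π.1.encode
  | .prop q => Tok.prop :: encodeName q
  | .conj φ ψ => Tok.conj :: (φ.encode ++ ψ.encode)
  | .neg φ => Tok.neg :: φ.encode

def TreeTerm.encode : TreeTerm α → List (Tok α)
  | .empty => [Tok.close]
  | .add d t s => Tok.item :: (encodeWord d ++ t.encode ++ s.encode)

def HAut.encode (H : HAut Pat) : List (Tok α) :=
  encodeList encodeName H.states ++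
    encodeList (fun r => encodeName r.1 ++ r.2.1.encode ++ encodeName r.2.2) H.rules

/-- As all descriptors of an `AUTC` have the same initial horizontal state `p₀`, a vertical rule
`(p₀, p') → q` is written as `p'` followed by `q`. -/
def AUTC.encode (C : AUTC Pat) : List (Tok α) :=
  C.H.encode ++ encodeName C.p₀.1 ++ encodeList encodeName C.A.states ++
    encodeList encodeName C.A.final ++
    encodeList (fun r => encodeName r.1.1.2.1 ++ encodeName r.2) C.A.rules

end Encodings

/-! ## Polynomial time and the two decision problems -/

/-- The property `P` of inputs `x`, written as `enc x`, is decided by a (multi-stack) Turing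
machine whose number of steps is bounded by a polynomial in the length of `enc x`. -/
def InPTime {β Γ : Type} (enc : β → List Γ) (P : β → Prop) : Prop :=
  open Classical in
  Nonempty (Turing.TM2ComputableInPolyTime enc Computability.encodeBool fun x => decide (P x))

/-- Inputs `(φ, d, Q)` of singleton-membership; `Q` is empty (`none`) or a singleton. -/
abbrev SingletonInstance {α : Type} (Pat : Set (Pattern α)) : Type :=
  EdgeFilter Pat × List α × Option Property

def SingletonInstance.encode {α : Type} {Pat : Set (Pattern α)} (x : SingletonInstance Pat) :
    List (Tok α) :=
  EdgeFilter.encode x.1 ++ encodeWord x.2.1 ++ encodeList encodeName x.2.2.toList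

/-- Whether `(d, Q) ⊨ φ`. -/
def SingletonInstance.Holds {α : Type} {Pat : Set (Pattern α)} (x : SingletonInstance Pat) :
    Prop :=
  EdgeFilter.Sat x.1 (x.2.1, {q | x.2.2 = some q})

/-- Inputs of the membership problem: an `AUTC` and a tree, given by any expression for it. -/
abbrev MembershipInstance {α : Type} (Pat : Set (Pattern α)) : Type :=
  AUTC Pat × TreeTerm α

def MembershipInstance.encode {α : Type} {Pat : Set (Pattern α)} (x : MembershipInstance Pat) :
    List (Tok α) :=
  AUTC.encode x.1 ++ TreeTerm.encode x.2

/-- Whether `t ∈ L(A)`. -/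
def MembershipInstance.Holds {α : Type} {Pat : Set (Pattern α)} (x : MembershipInstance Pat) :
    Prop :=
  TreeTerm.toTree x.2 ∈ AUTC.language x.1

end UTA

/-!
The algorithm evaluates the tree bottom-up. At each node it runs the horizontal automaton greedily:
it passes over the multiset of children as many times as there are children, consuming every child
to which a rule applies in the current horizontal state. A pass that consumes nothing shows that the
automaton is stuck, so after these passes it is stuck or has consumed all children. Confluence makes
the greedy choice harmless: if some run consumed all children while the greedy run got stuck, then
the configuration without children would have to be joined with `⊥`, and both are irreducible.
Vertical determinism ensures that every child carries at most one state, so that testing the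
applicability of a rule is an instance of singleton-membership of filters.

To turn this into a Turing machine, the machine deciding singleton-membership is embedded in a
larger multi-stack machine as a subroutine. Data are S-expressions written on a stack in Polish
notation, and the functions on them that such a machine computes in polynomial time are closed under
composition, pairing, case distinction and iteration over a list, provided that the accumulator of
the iteration stays of polynomial size.
-/

namespace UTA

open Turing StateTransition Relation

/-! ## Programs for stack machines -/

section Programs

/-- `EvalsWithin f t a b` means that at most `t` applications of the step function `f` lead from `a`
to `b`. -/
def EvalsWithin {A : Type*} (f : A → Option A) (t : ℕ) (a b : A) : Prop :=
  Nonempty (EvalsToInTime f a (some b) t)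

namespace EvalsWithin

variable {A B : Type*} {f : A → Option A} {s t : ℕ} {a b c : A}

theorem refl (f : A → Option A) (a : A) : EvalsWithin f 0 a a := ⟨.refl f a⟩

theorem head (h : f a = some b) (h' : EvalsWithin f t b c) : EvalsWithin f (t + 1) a c :=
  h'.map <| .trans f 1 t a b (some c) ⟨⟨1, h⟩, le_rfl⟩

theorem trans (h : EvalsWithin f s a b) (h' : EvalsWithin f t b c) :
    EvalsWithin f (s + t) a c :=
  let ⟨H⟩ := h; let ⟨H'⟩ := h'
  ⟨add_comm t s ▸ .trans f s t a b (some c) H H'⟩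

theorem mono (h : EvalsWithin f s a b) (hst : s ≤ t) : EvalsWithin f t a b :=
  h.map fun H => ⟨H.toEvalsTo, H.steps_le_m.trans hst⟩

theorem map {g : B → Option B} (φ : A → B)
    (hφ : ∀ a b, f a = some b → g (φ a) = some (φ b)) (h : EvalsWithin f t a b) :
    EvalsWithin g t (φ a) (φ b) := by
  obtain ⟨⟨n, hn⟩, hnt⟩ := h
  refine ⟨⟨⟨n, ?_⟩, hnt⟩⟩
  clear hnt
  induction n generalizing b with
  | zero => exact congrArg (Option.map φ) hn
  | succ n ih =>
    rw [Function.iterate_succ_apply'] at hn ⊢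
    obtain ⟨d, hd, hdb⟩ := Option.bind_eq_some_iff.1 hn
    rw [ih hd]
    exact hφ d b hdb

end EvalsWithin

variable {K : Type} [DecidableEq K] {Γ : K → Type} {Λ Λ' σ : Type}

/-- Rename the labels of a statement by `f` and replace halting by a jump to `next`, if given. -/
def relabel (f : Λ → Λ') (next : Option Λ') : TM2.Stmt Γ Λ σ → TM2.Stmt Γ Λ' σ
  | .push k g q => .push k g (relabel f next q)
  | .peek k g q => .peek k g (relabel f next q)
  | .pop k g q => .pop k g (relabel f next q)
  | .load g q => .load g (relabel f next q)
  | .branch g q q' => .branch g (relabel f next q) (relabel f next q')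
  | .goto g => .goto fun v => f (g v)
  | .halt => next.elim .halt fun l => .goto fun _ => l

/-- The effect of `relabel f next` on configurations. -/
def relabelCfg (f : Λ → Λ') (next : Option Λ') (c : TM2.Cfg Γ Λ σ) : TM2.Cfg Γ Λ' σ :=
  ⟨c.l.elim next fun l => some (f l), c.var, c.stk⟩

theorem stepAux_relabel (f : Λ → Λ') (next : Option Λ') (q : TM2.Stmt Γ Λ σ) (v : σ)
    (S : ∀ k, List (Γ k)) :
    TM2.stepAux (relabel f next q) v S = relabelCfg f next (TM2.stepAux q v S) := by
  induction q generalizing v S with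
  | push | peek | pop | load => simp only [relabel, TM2.stepAux, *]
  | branch g q q' ih ih' => cases hg : g v <;> simp [relabel, TM2.stepAux, hg, ih, ih']
  | goto => rfl
  | halt => cases next <;> rfl

theorem EvalsWithin.relabel {f : Λ → Λ'} {next : Option Λ'} {m : Λ → TM2.Stmt Γ Λ σ}
    {m' : Λ' → TM2.Stmt Γ Λ' σ} (hm : ∀ l, m' (f l) = relabel f next (m l)) {t : ℕ}
    {c c' : TM2.Cfg Γ Λ σ} (h : EvalsWithin (TM2.step m) t c c') :
    EvalsWithin (TM2.step m') t (relabelCfg f next c) (relabelCfg f next c') := by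
  refine h.map _ ?_
  rintro ⟨_ | l, v, S⟩ d hd
  · simp only [TM2.step, reduceCtorEq] at hd
  · obtain rfl := Option.some.inj hd
    exact congrArg some ((congrArg (TM2.stepAux · v S) (hm l)).trans
      (stepAux_relabel f next (m l) v S))

variable (Γ σ) in
/-- A program for a machine with stack alphabets `Γ` and internal states `σ`: a finite set of
labelled statements with a start label. In contrast to `Turing.FinTM2`, no stacks are singled out
for input and output, so that programs can be composed. -/
structure Program where
  Λ : Type
  fintype : Fintype Λ
  start : Λ
  stmt : Λ → TM2.Stmt Γ Λ σ

namespace Program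

/-- The data a program works on: the internal state and the contents of the stacks. -/
abbrev Data {K : Type} (Γ : K → Type) (σ : Type) : Type := σ × ∀ k, List (Γ k)

/-- Started on `x`, the program halts with `y` after at most `t` steps. -/
def Runs (F : Program Γ σ) (t : ℕ) (x y : Data Γ σ) : Prop :=
  EvalsWithin (TM2.step F.stmt) t ⟨some F.start, x.1, x.2⟩ ⟨none, y.1, y.2⟩

variable {F G : Program Γ σ} {s t : ℕ} {v v' : σ} {S S' : ∀ k, List (Γ k)} {x y z : Data Γ σ}

theorem Runs.mono (h : F.Runs s x y) (hst : s ≤ t) : F.Runs t x y := EvalsWithin.mono h hst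

theorem Runs.congr (h : F.Runs s x y) (hst : s ≤ t) (hyz : y = z) : F.Runs t x z :=
  hyz ▸ h.mono hst

/-- The program consisting of a single statement; every jump repeats it. -/
def repeatStmt (q : TM2.Stmt Γ Unit σ) : Program Γ σ := ⟨Unit, inferInstance, (), fun _ => q⟩

theorem runs_repeatStmt_of_halt {q : TM2.Stmt Γ Unit σ}
    (h : TM2.stepAux q v S = ⟨none, v', S'⟩) : (repeatStmt q).Runs 1 (v, S) (v', S') :=
  (EvalsWithin.refl _ _).head (congrArg some h)

theorem runs_repeatStmt_of_goto {q : TM2.Stmt Γ Unit σ}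
    (h : TM2.stepAux q v S = ⟨some (), v', S'⟩) (H : (repeatStmt q).Runs t (v', S') y) :
    (repeatStmt q).Runs (t + 1) (v, S) y :=
  EvalsWithin.head (congrArg some h) H

/-- First `F`, then `G`. -/
def seq (F G : Program Γ σ) : Program Γ σ where
  Λ := F.Λ ⊕ G.Λ
  fintype := letI := F.fintype; letI := G.fintype; inferInstance
  start := .inl F.start
  stmt := Sum.elim (fun l => relabel .inl (some (.inr G.start)) (F.stmt l))
    fun l => relabel .inr none (G.stmt l)

theorem Runs.seq (h : F.Runs s x y) (h' : G.Runs t y z) : (F.seq G).Runs (s + t) x z :=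
  EvalsWithin.trans (b := ⟨some (.inr G.start), y.1, y.2⟩)
    (h.relabel (f := Sum.inl) (next := some (.inr G.start)) fun _ => rfl)
    (h'.relabel (f := Sum.inr) (next := none) fun _ => rfl)

/-- Perform `q`; continue with `F` if it jumps to `true` and with `G` if it jumps to `false`. -/
def ite (q : TM2.Stmt Γ Bool σ) (F G : Program Γ σ) : Program Γ σ where
  Λ := Option (F.Λ ⊕ G.Λ)
  fintype := letI := F.fintype; letI := G.fintype; inferInstance
  start := none
  stmt l := l.elim (relabel (fun b => some (cond b (.inl F.start) (.inr G.start))) none q)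
    (Sum.elim (fun l => relabel (fun l => some (.inl l)) none (F.stmt l))
      fun l => relabel (fun l => some (.inr l)) none (G.stmt l))

theorem runs_ite_true {q : TM2.Stmt Γ Bool σ}
    (h : TM2.stepAux q v S = ⟨some true, v', S'⟩) (H : F.Runs t (v', S') y) :
    (ite q F G).Runs (t + 1) (v, S) y :=
  (H.relabel (f := fun l => some (Sum.inl l)) (next := none) (m' := (ite q F G).stmt)
    fun _ => rfl).head (congrArg some ((stepAux_relabel _ _ q v S).trans (congrArg _ h)))

theorem runs_ite_false {q : TM2.Stmt Γ Bool σ}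
    (h : TM2.stepAux q v S = ⟨some false, v', S'⟩) (H : G.Runs t (v', S') y) :
    (ite q F G).Runs (t + 1) (v, S) y :=
  (H.relabel (f := fun l => some (Sum.inr l)) (next := none) (m' := (ite q F G).stmt)
    fun _ => rfl).head (congrArg some ((stepAux_relabel _ _ q v S).trans (congrArg _ h)))

/-- Perform `q`; if it jumps, perform `F` and start again. -/
def loop (q : TM2.Stmt Γ Unit σ) (F : Program Γ σ) : Program Γ σ where
  Λ := Option F.Λ
  fintype := letI := F.fintype; inferInstance
  start := none
  stmt l := l.elim (relabel (fun _ => some F.start) none q)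
    fun l => relabel some (some none) (F.stmt l)

theorem runs_loop_of_halt {q : TM2.Stmt Γ Unit σ}
    (h : TM2.stepAux q v S = ⟨none, v', S'⟩) : (loop q F).Runs 1 (v, S) (v', S') :=
  (EvalsWithin.refl _ _).head
    (congrArg some ((stepAux_relabel _ _ q v S).trans (congrArg _ h)))

theorem runs_loop_of_goto {q : TM2.Stmt Γ Unit σ}
    (h : TM2.stepAux q v S = ⟨some (), v', S'⟩) (H : F.Runs s (v', S') y)
    (H' : (loop q F).Runs t y z) : (loop q F).Runs (s + t + 1) (v, S) z :=
  EvalsWithin.head (congrArg some ((stepAux_relabel _ _ q v S).trans (congrArg _ h)))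
    ((H.relabel (f := some) (next := some none) (m' := (loop q F).stmt) fun _ => rfl).trans H')

end Program

end Programs

/-! ## S-expressions and the memory -/

section Memory

/-- S-expressions over `τ`, that is, binary trees whose leaves are letters or `nil`. They are the
data type of the algorithms below. -/
inductive Sexp (τ : Type) : Type where
  | nil
  | atom (a : τ)
  | cons (x y : Sexp τ)

/-- The stack symbols used to write S-expressions in prefix notation. -/
inductive Symbol (τ : Type) : Type where
  | nil
  | atom (a : τ)
  | cons
  deriving Fintype

/-- The prefix notation of an S-expression. -/
def Sexp.code {τ : Type} : Sexp τ → List (Symbol τ)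
  | .nil => [.nil]
  | .atom a => [.atom a]
  | .cons x y => .cons :: (x.code ++ y.code)

/-- Types whose elements are represented by S-expressions over `τ`. -/
class ToSexp (τ A : Type) where
  toSexp : A → Sexp τ

section ToSexp

variable {τ A B : Type}

instance : ToSexp τ τ := ⟨.atom⟩

instance : ToSexp τ Bool := ⟨fun b => cond b (.cons .nil .nil) .nil⟩

instance [ToSexp τ A] [ToSexp τ B] : ToSexp τ (A × B) :=
  ⟨fun x => .cons (ToSexp.toSexp x.1) (ToSexp.toSexp x.2)⟩

instance [ToSexp τ A] : ToSexp τ (List A) :=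
  ⟨fun l => l.foldr (fun a x => .cons (ToSexp.toSexp a) x) .nil⟩

instance [ToSexp τ A] : ToSexp τ (Option A) :=
  ⟨fun o => o.elim .nil fun a => .cons (ToSexp.toSexp a) .nil⟩

theorem toSexp_map [ToSexp τ A] [ToSexp τ B] {f : A → B}
    (h : ∀ a, (ToSexp.toSexp (f a) : Sexp τ) = ToSexp.toSexp a) (l : List A) :
    (ToSexp.toSexp (l.map f) : Sexp τ) = ToSexp.toSexp l := by
  induction l with
  | nil => rfl
  | cons a l ih => exact congrArg₂ Sexp.cons (h a) ih

variable (τ)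

/-- The prefix notation of the representation of `a`. -/
def code [ToSexp τ A] (a : A) : List (Symbol τ) := (ToSexp.toSexp a : Sexp τ).code

@[simp] theorem code_atom (a : τ) : code τ a = [.atom a] := rfl

@[simp] theorem code_true : code τ true = [.cons, .nil, .nil] := rfl

@[simp] theorem code_false : code τ false = [.nil] := rfl

@[simp] theorem code_prod [ToSexp τ A] [ToSexp τ B] (x : A × B) :
    code τ x = .cons :: (code τ x.1 ++ code τ x.2) := rfl

@[simp] theorem code_nil [ToSexp τ A] : code τ ([] : List A) = [.nil] := rfl

@[simp] theorem code_cons [ToSexp τ A] (a : A) (l : List A) :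
    code τ (a :: l) = .cons :: (code τ a ++ code τ l) := rfl

@[simp] theorem code_some [ToSexp τ A] (a : A) :
    code τ (some a) = .cons :: (code τ a ++ [.nil]) := rfl

end ToSexp

/-- The stacks that hold S-expressions; terms are evaluated on `main`. -/
inductive Reg : Type where
  | main | counter | aux₁ | aux₂ | aux₃
  deriving DecidableEq

instance : Fintype Reg := ⟨{.main, .counter, .aux₁, .aux₂, .aux₃}, fun r => by cases r <;> decide⟩

/-- Names of stacks: the registers, an input and an output stack, and those of a subroutine. -/
inductive Stack (K : Type) : Type where
  | reg (r : Reg)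
  | input
  | output
  | sub (k : K)
  deriving DecidableEq, Fintype

/-- The alphabets of the stacks, for a subroutine with stack alphabets `Γ`. -/
abbrev Stack.Alphabet (τ : Type) {K : Type} (Γ : K → Type) : Stack K → Type
  | .reg _ => Symbol τ
  | .input => τ
  | .output => Bool
  | .sub k => Γ k

variable {τ K : Type} {Γ : K → Type}

/-- The contents of all stacks: `R` for the registers, `i` for the input, `o` for the output and `S`
for the subroutine. -/
def store (R : Reg → List (Symbol τ)) (i : List τ) (o : List Bool) (S : ∀ k, List (Γ k)) :
    ∀ k, List (Stack.Alphabet τ Γ k)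
  | .reg r => R r
  | .input => i
  | .output => o
  | .sub k => S k

variable (R : Reg → List (Symbol τ)) (i : List τ) (o : List Bool) (S : ∀ k, List (Γ k))

@[simp] theorem store_reg (r : Reg) : store R i o S (.reg r) = R r := rfl
@[simp] theorem store_input : store R i o S .input = i := rfl
@[simp] theorem store_sub (k : K) : store R i o S (.sub k) = S k := rfl

variable [DecidableEq K]

@[simp] theorem update_store_reg (r : Reg) (l : List (Symbol τ)) :
    Function.update (store R i o S) (.reg r) l = store (Function.update R r l) i o S := by
  funext k
  rcases k with r' | _ | _ | _
  · rcases eq_or_ne r' r with rfl | h <;> simp_all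
  · rfl
  · rfl
  · rfl

@[simp] theorem update_store_input (l : List τ) :
    Function.update (store R i o S) .input l = store R l o S := by
  funext k; cases k <;> simp [Function.update, store]

@[simp] theorem update_store_output (l : List Bool) :
    Function.update (store R i o S) .output l = store R i l S := by
  funext k; cases k <;> simp [Function.update, store]

@[simp] theorem update_store_sub (k : K) (l : List (Γ k)) :
    Function.update (store R i o S) (.sub k) l = store R i o (Function.update S k l) := by
  funext k'
  rcases k' with _ | _ | _ | k'
  · rfl
  · rfl
  · rfl
  · rcases eq_or_ne k' k with rfl | h <;> simp_all

/-- The register contents where only `main` is nonempty. -/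
def onlyMain (l : List (Symbol τ)) : Reg → List (Symbol τ) := Function.update (fun _ => []) .main l

@[simp] theorem onlyMain_main (l : List (Symbol τ)) : onlyMain l .main = l := rfl

@[simp] theorem onlyMain_of_ne {r : Reg} (hr : r ≠ .main) (l : List (Symbol τ)) :
    onlyMain l r = [] := Function.update_of_ne hr _ _

@[simp] theorem update_onlyMain (l l' : List (Symbol τ)) :
    Function.update (onlyMain l) .main l' = onlyMain l' := Function.update_idem _ _ _

@[simp] theorem update_onlyMain_nil {r : Reg} (hr : r ≠ .main) (l : List (Symbol τ)) :
    Function.update (onlyMain l) r [] = onlyMain l := by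
  rw [← onlyMain_of_ne hr l, Function.update_eq_self]

@[simp] theorem update_update_onlyMain {r : Reg} (hr : r ≠ .main) (l l' x : List (Symbol τ)) :
    Function.update (Function.update (onlyMain l) r x) .main l' =
      Function.update (onlyMain l') r x := by
  rw [Function.update_comm hr, update_onlyMain]

end Memory

/-! ## Programs evaluating terms on a stack -/

section Basic

variable {τ K : Type} [DecidableEq K] {Γ : K → Type} {Λ σ : Type}

/-- The internal states of the programs below: a buffer for one symbol and a state of the
subroutine. -/
abbrev State (τ σ : Type) : Type := Option (Symbol τ) × σ

/-- Whether the buffer holds the symbol `cons`. -/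
def State.holdsCons (v : State τ σ) : Bool :=
  match v.1 with
  | some .cons => true
  | _ => false

namespace Program

/-- Pop a symbol from `r` into the buffer. -/
def popTo (r : Reg) (q : TM2.Stmt (Stack.Alphabet τ Γ) Λ (State τ σ)) :
    TM2.Stmt (Stack.Alphabet τ Γ) Λ (State τ σ) :=
  .pop (.reg r) (fun v s => (s, v.2)) q

/-- Push the symbol in the buffer, which must not be empty, to `r`. -/
def pushFrom (r : Reg) (q : TM2.Stmt (Stack.Alphabet τ Γ) Λ (State τ σ)) :
    TM2.Stmt (Stack.Alphabet τ Γ) Λ (State τ σ) :=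
  .push (.reg r) (fun v => v.1.getD .nil) q

/-- Push the symbol `s` to `r`. -/
def pushSymbol (r : Reg) (s : Symbol τ) (q : TM2.Stmt (Stack.Alphabet τ Γ) Λ (State τ σ)) :
    TM2.Stmt (Stack.Alphabet τ Γ) Λ (State τ σ) :=
  .push (.reg r) (fun _ => s) q

/-- Clear the buffer. -/
def clearBuffer (q : TM2.Stmt (Stack.Alphabet τ Γ) Λ (State τ σ)) :
    TM2.Stmt (Stack.Alphabet τ Γ) Λ (State τ σ) :=
  .load (fun v => (none, v.2)) q

/-- Pop symbols from `src` and push each of them to all of `dsts`, until `src` is empty. -/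
def moveAll (src : Reg) (dsts : List Reg) : Program (Stack.Alphabet τ Γ) (State τ σ) :=
  repeatStmt <| popTo src <| .branch (fun v => v.1.isSome)
    (dsts.foldr pushFrom (.goto fun _ => ())) (clearBuffer .halt)

theorem stepAux_foldr_pushFrom {dsts : List Reg} (hdsts : dsts.Nodup)
    (q : TM2.Stmt (Stack.Alphabet τ Γ) Λ (State τ σ)) (s : Symbol τ) (w : σ)
    (R : Reg → List (Symbol τ)) (i : List τ) (o : List Bool) (S : ∀ k, List (Γ k)) :
    TM2.stepAux (dsts.foldr pushFrom q) (some s, w) (store R i o S) =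
      TM2.stepAux q (some s, w) (store (fun r => if r ∈ dsts then s :: R r else R r) i o S) := by
  induction dsts generalizing R with
  | nil => simp
  | cons d dsts ih =>
    obtain ⟨hd, hdsts⟩ := List.nodup_cons.1 hdsts
    simp only [List.foldr_cons, pushFrom, TM2.stepAux, update_store_reg, store_reg,
      Option.getD_some]
    rw [ih hdsts]
    congr 2
    funext r
    rcases eq_or_ne r d with rfl | hr <;> simp [*]

theorem runs_moveAll {src : Reg} {dsts : List Reg} (hsrc : src ∉ dsts) (hdsts : dsts.Nodup)
    (v : Option (Symbol τ)) (w : σ) (R : Reg → List (Symbol τ)) (i : List τ) (o : List Bool)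
    (S : ∀ k, List (Γ k)) :
    (moveAll src dsts).Runs ((R src).length + 1) ((v, w), store R i o S)
      ((none, w), store
        (fun r => if r = src then [] else if r ∈ dsts then (R src).reverse ++ R r else R r)
        i o S) := by
  induction hL : R src generalizing v R with
  | nil =>
    have hR : Function.update R src [] = R := by rw [← hL, Function.update_eq_self]
    refine (runs_repeatStmt_of_halt (v' := (none, w)) (S' := store R i o S) ?_).congr le_rfl ?_
    · simp [popTo, clearBuffer, hL, hR]
    · congr 2; funext r; split_ifs <;> simp_all
  | cons s L ih =>
    refine (runs_repeatStmt_of_goto (v' := (some s, w)) ?_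
      (ih (some s) (fun r => if r ∈ dsts then s :: R r else Function.update R src L r)
        (by simp [hsrc]))).congr le_rfl ?_
    · simp only [popTo, TM2.stepAux, store_reg, update_store_reg, hL, List.head?_cons,
        List.tail_cons, Option.isSome_some, cond_true, stepAux_foldr_pushFrom hdsts]
      congr 2
      funext r
      split_ifs with h
      · rw [Function.update_of_ne (ne_of_mem_of_not_mem h hsrc)]
      · rfl
    · congr 2; funext r; split_ifs <;> simp_all

/-- The body of `moveTerm`. The number of symbols on `counter` is the number of terms that are still
to be moved. -/
def moveTermStmt (dst : Reg) : TM2.Stmt (Stack.Alphabet τ Γ) Unit (State τ σ) :=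
  popTo .counter <| .branch (fun v => v.1.isSome)
    (popTo .main <| pushFrom dst <| .branch State.holdsCons
      (pushSymbol .counter .nil <| pushSymbol .counter .nil <| .goto fun _ => ())
      (.goto fun _ => ()))
    (clearBuffer .halt)

variable {dst : Reg} {v : Option (Symbol τ)} {w : σ} {R : Reg → List (Symbol τ)} {i : List τ}
  {o : List Bool} {S : ∀ k, List (Γ k)}

theorem stepAux_moveTermStmt (hdst : dst ∉ [.main, .counter]) {k : ℕ} {s : Symbol τ}
    {l : List (Symbol τ)} (hc : R .counter = List.replicate (k + 1) .nil)
    (hm : R .main = s :: l) :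
    TM2.stepAux (moveTermStmt dst) (v, w) (store R i o S) =
      ⟨some (), (some s, w), store (Function.update (Function.update (Function.update R .main l)
        dst (s :: R dst)) .counter
          (List.replicate (if State.holdsCons (some s, w) then k + 2 else k) .nil)) i o S⟩ := by
  simp only [List.mem_cons, List.not_mem_nil, or_false, not_or] at hdst
  have hR : Function.update (Function.update (Function.update R .counter (List.replicate k .nil))
      .main l) dst (s :: R dst) = Function.update (Function.update (Function.update R .main l)
        dst (s :: R dst)) .counter (List.replicate k .nil) := by
    rw [Function.update_comm (a := Reg.counter) (b := .main) (by decide),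
      Function.update_comm (a := Reg.counter) (Ne.symm hdst.2)]
  by_cases h : State.holdsCons (some s, w) <;>
    simp [moveTermStmt, popTo, pushFrom, pushSymbol, h, hc, hm, hdst, hR, List.replicate_succ]

theorem runs_moveTermStmt (hdst : dst ∉ [.main, .counter]) (x : Sexp τ) {k t : ℕ}
    {l : List (Symbol τ)} {y : Data (Stack.Alphabet τ Γ) (State τ σ)}
    (hc : R .counter = List.replicate (k + 1) .nil) (hm : R .main = x.code ++ l)
    (H : ∀ v, (repeatStmt (moveTermStmt dst)).Runs t ((v, w), store (Function.update
      (Function.update (Function.update R .main l) dst (x.code.reverse ++ R dst)) .counter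
        (List.replicate k .nil)) i o S) y) :
    (repeatStmt (moveTermStmt dst)).Runs (t + x.code.length) ((v, w), store R i o S) y := by
  induction x generalizing k l t v R with
  | nil => exact runs_repeatStmt_of_goto (stepAux_moveTermStmt hdst hc hm) (H (some .nil))
  | atom a => exact runs_repeatStmt_of_goto (stepAux_moveTermStmt hdst hc hm) (H (some (.atom a)))
  | cons x₁ x₂ ih₁ ih₂ =>
    have hd := hdst
    simp only [List.mem_cons, List.not_mem_nil, or_false, not_or] at hd
    refine (runs_repeatStmt_of_goto (stepAux_moveTermStmt hdst hc hm)
      (ih₁ (k := k + 1) (l := x₂.code ++ l) (by simp [State.holdsCons])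
        (by simp [Ne.symm hd.1]) fun v =>
          ih₂ (k := k) (l := l) (t := t) (by simp) (by simp [Function.update_apply, Ne.symm hd.1])
            fun v => ?_)).mono ?_
    swap; · simp only [Sexp.code, List.length_cons, List.length_append]; omega
    convert H v using 3
    funext r
    simp only [Function.update_apply]
    split_ifs <;> simp_all [Sexp.code]

/-- Move the topmost term of `main` to `dst`, reversing its prefix notation. -/
def moveTerm (dst : Reg) : Program (Stack.Alphabet τ Γ) (State τ σ) :=
  (repeatStmt (pushSymbol .counter .nil .halt)).seq (repeatStmt (moveTermStmt dst))

theorem runs_moveTerm (hdst : dst ∉ [.main, .counter]) (x : Sexp τ) {l : List (Symbol τ)}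
    (hc : R .counter = []) (hm : R .main = x.code ++ l) :
    (moveTerm dst).Runs (x.code.length + 2) ((none, w), store R i o S)
      ((none, w), store (Function.update (Function.update R .main l) dst
        (x.code.reverse ++ R dst)) i o S) := by
  have hd := hdst
  simp only [List.mem_cons, List.not_mem_nil, or_false, not_or] at hd
  refine (Runs.seq (runs_repeatStmt_of_halt (v' := (none, w))
    (S' := store (Function.update R .counter [.nil]) i o S) ?_)
    (runs_moveTermStmt hdst x (k := 0) (l := l) (t := 1) ?_ ?_ fun v =>
      runs_repeatStmt_of_halt ?_)).mono (by omega)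
  · simp [pushSymbol, hc]
  · simp
  · simp [hm]
  · simp only [moveTermStmt, popTo, clearBuffer, TM2.stepAux, store_reg, update_store_reg,
      Function.update_self, List.replicate_zero, List.head?_nil, List.tail_nil,
      Option.isSome_none, cond_false, TM2.Cfg.mk.injEq, true_and]
    congr 1
    funext r
    simp only [Function.update_apply]
    split_ifs <;> simp_all

/-- The configuration with registers `R` in which all other stacks and the buffer are empty. -/
abbrev atRest (w : σ) (R : Reg → List (Symbol τ)) : Data (Stack.Alphabet τ Γ) (State τ σ) :=
  ((none, w), store R [] [] fun _ => [])

/-- In at most `t` steps, the program replaces `x` by `y` on top of `main` if it is started in the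
state `w` with all other stacks empty. -/
def Computes (F : Program (Stack.Alphabet τ Γ) (State τ σ)) (w : σ) (t : ℕ)
    (x y : List (Symbol τ)) : Prop :=
  ∀ l, F.Runs t (atRest w (onlyMain (x ++ l))) (atRest w (onlyMain (y ++ l)))

section Computes

variable {F G : Program (Stack.Alphabet τ Γ) (State τ σ)} {s t : ℕ} {x y z : List (Symbol τ)}

theorem Computes.mono (h : F.Computes w s x y) (hst : s ≤ t) : F.Computes w t x y :=
  fun l => (h l).mono hst

theorem Computes.seq (h : F.Computes w s x y) (h' : G.Computes w t y z) :
    (F.seq G).Computes w (s + t) x z :=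
  fun l => (h l).seq (h' l)

theorem Computes.append (h : F.Computes w t x y) (z : List (Symbol τ)) :
    F.Computes w t (x ++ z) (y ++ z) := fun l => by
  simpa only [List.append_assoc] using h (z ++ l)

end Computes

/-- Duplicate the topmost term. -/
def dup : Program (Stack.Alphabet τ Γ) (State τ σ) :=
  (moveTerm .aux₁).seq ((moveAll .aux₁ [.main, .aux₂]).seq
    ((moveAll .aux₂ [.aux₁]).seq (moveAll .aux₁ [.main])))

theorem computes_dup (x : Sexp τ) :
    (dup (Γ := Γ)).Computes w (4 * x.code.length + 5) x.code (x.code ++ x.code) := fun l => by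
  refine ((runs_moveTerm (by decide) x (l := l) (by simp) (by simp)).seq
    ((runs_moveAll (by decide) (by decide) ..).seq
      ((runs_moveAll (by decide) (by decide) ..).seq
        (runs_moveAll (by decide) (by decide) ..)))).congr ?_ ?_
  · simp only [update_onlyMain, ne_eq, reduceCtorEq, not_false_eq_true, onlyMain_of_ne,
      List.append_nil, Function.update_self, Function.update_of_ne, List.length_reverse, ↓reduceIte,
      List.mem_cons, List.not_mem_nil, or_false, or_true, List.reverse_reverse]
    omega
  · congr 2
    funext r; cases r <;> simp

/-- Exchange the two topmost terms. -/
def swap : Program (Stack.Alphabet τ Γ) (State τ σ) :=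
  (moveTerm .aux₁).seq ((moveTerm .aux₂).seq ((moveAll .aux₁ [.main]).seq
    (moveAll .aux₂ [.main])))

theorem computes_swap (x y : Sexp τ) :
    (swap (Γ := Γ)).Computes w (2 * x.code.length + 2 * y.code.length + 6) (x.code ++ y.code)
      (y.code ++ x.code) := fun l => by
  refine ((runs_moveTerm (by decide) x (l := y.code ++ l) (by simp) (by simp)).seq
    ((runs_moveTerm (by decide) y (l := l) (by simp) (by simp)).seq
      ((runs_moveAll (by decide) (by decide) ..).seq
        (runs_moveAll (by decide) (by decide) ..)))).congr ?_ ?_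
  · simp only [List.append_assoc, update_onlyMain, ne_eq, reduceCtorEq, not_false_eq_true,
      onlyMain_of_ne, List.append_nil, update_update_onlyMain, Function.update_of_ne,
      Function.update_self, List.length_reverse, ↓reduceIte, List.mem_cons, List.not_mem_nil,
      or_self]
    omega
  · congr 2
    funext r; cases r <;> simp

/-- Remove the topmost term. -/
def drop : Program (Stack.Alphabet τ Γ) (State τ σ) := (moveTerm .aux₁).seq (moveAll .aux₁ [])

theorem computes_drop (x : Sexp τ) :
    (drop (Γ := Γ)).Computes w (2 * x.code.length + 3) x.code [] := fun l => by
  refine ((runs_moveTerm (by decide) x (l := l) (by simp) (by simp)).seq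
    (runs_moveAll (by decide) (by decide) ..)).congr ?_ ?_
  · simp only [update_onlyMain, ne_eq, reduceCtorEq, not_false_eq_true, onlyMain_of_ne,
      List.append_nil, Function.update_self, List.length_reverse]
    omega
  · congr 2
    funext r; cases r <;> simp

/-- Exchange the second and the third term. -/
def rotate : Program (Stack.Alphabet τ Γ) (State τ σ) :=
  (moveTerm .aux₁).seq ((moveTerm .aux₂).seq ((moveTerm .aux₃).seq ((moveAll .aux₂ [.main]).seq
    ((moveAll .aux₃ [.main]).seq (moveAll .aux₁ [.main])))))

theorem computes_rotate (x y z : Sexp τ) :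
    (rotate (Γ := Γ)).Computes w
      (2 * x.code.length + 2 * y.code.length + 2 * z.code.length + 9)
      (x.code ++ (y.code ++ z.code)) (x.code ++ (z.code ++ y.code)) := fun l => by
  refine ((runs_moveTerm (by decide) x (l := y.code ++ z.code ++ l) (by simp) (by simp)).seq
    ((runs_moveTerm (by decide) y (l := z.code ++ l) (by simp) (by simp)).seq
      ((runs_moveTerm (by decide) z (l := l) (by simp) (by simp)).seq
        ((runs_moveAll (by decide) (by decide) ..).seq
          ((runs_moveAll (by decide) (by decide) ..).seq
            (runs_moveAll (by decide) (by decide) ..)))))).congr ?_ ?_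
  · simp only [List.append_assoc, update_onlyMain, ne_eq, reduceCtorEq, not_false_eq_true,
      onlyMain_of_ne, List.append_nil, update_update_onlyMain, Function.update_of_ne,
      Function.update_self, List.length_reverse, ↓reduceIte, List.mem_cons, List.not_mem_nil,
      or_self]
    omega
  · congr 2
    funext r; cases r <;> simp

theorem computes_repeatStmt {q : TM2.Stmt (Stack.Alphabet τ Γ) Unit (State τ σ)}
    {x y : List (Symbol τ)}
    (h : ∀ l, TM2.stepAux q (none, w) (store (onlyMain (x ++ l)) [] [] fun _ => []) =
      ⟨none, (none, w), store (onlyMain (y ++ l)) [] [] fun _ => []⟩) :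
    (repeatStmt q).Computes w 1 x y := fun l => runs_repeatStmt_of_halt (h l)

/-- Push the symbol `cons`. -/
def pushCons : Program (Stack.Alphabet τ Γ) (State τ σ) :=
  repeatStmt (pushSymbol .main .cons .halt)

theorem computes_pushCons (x : List (Symbol τ)) :
    (pushCons (Γ := Γ)).Computes w 1 x (.cons :: x) :=
  computes_repeatStmt fun l => by simp [pushSymbol]

/-- Remove the topmost symbol. -/
def pop : Program (Stack.Alphabet τ Γ) (State τ σ) :=
  repeatStmt (popTo .main <| clearBuffer .halt)

theorem computes_pop (s : Symbol τ) (x : List (Symbol τ)) :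
    (pop (Γ := Γ)).Computes w 1 (s :: x) x :=
  computes_repeatStmt fun l => by simp [popTo, clearBuffer]

/-- Push the symbols of `x`. -/
def pushConst (x : List (Symbol τ)) : Program (Stack.Alphabet τ Γ) (State τ σ) :=
  repeatStmt (x.reverse.foldr (pushSymbol .main) .halt)

theorem stepAux_foldr_pushSymbol (x l : List (Symbol τ)) :
    TM2.stepAux (x.foldr (pushSymbol .main) (.halt : TM2.Stmt (Stack.Alphabet τ Γ) Unit _)) (v, w)
      (store (onlyMain l) i o S) = ⟨none, (v, w), store (onlyMain (x.reverse ++ l)) i o S⟩ := by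
  induction x generalizing l with
  | nil => rfl
  | cons s x ih => simpa [pushSymbol] using ih (s :: l)

theorem computes_pushConst (x : List (Symbol τ)) : (pushConst (Γ := Γ) x).Computes w 1 [] x :=
  computes_repeatStmt fun l => by simpa using stepAux_foldr_pushSymbol x.reverse l

/-- Pop a symbol and go on with `F` if it is `cons` and with `G` otherwise. -/
def caseCons (F G : Program (Stack.Alphabet τ Γ) (State τ σ)) :
    Program (Stack.Alphabet τ Γ) (State τ σ) :=
  ite (popTo .main <| .branch State.holdsCons (clearBuffer <| .goto fun _ => true)
    (clearBuffer <| .goto fun _ => false)) F G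

section Control

variable {F G : Program (Stack.Alphabet τ Γ) (State τ σ)} {s t : ℕ} {x y z : List (Symbol τ)}

theorem computes_caseCons_cons (h : F.Computes w t x y) :
    (caseCons F G).Computes w (t + 1) (.cons :: x) y := fun l =>
  runs_ite_true (by simp [popTo, State.holdsCons, clearBuffer]) (h l)

theorem computes_caseCons_nil (h : G.Computes w t x y) :
    (caseCons F G).Computes w (t + 1) (.nil :: x) y := fun l =>
  runs_ite_false (by simp [popTo, State.holdsCons, clearBuffer]) (h l)

/-- While the topmost symbol is `cons`, pop it and perform `F`; finally, pop the topmost symbol. -/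
def whileCons (F : Program (Stack.Alphabet τ Γ) (State τ σ)) :
    Program (Stack.Alphabet τ Γ) (State τ σ) :=
  loop (popTo .main <| .branch State.holdsCons (clearBuffer <| .goto fun _ => ())
    (clearBuffer .halt)) F

theorem computes_whileCons_nil (x : List (Symbol τ)) :
    (whileCons F).Computes w 1 (.nil :: x) x := fun l =>
  runs_loop_of_halt (by simp [popTo, State.holdsCons, clearBuffer])

theorem computes_whileCons_cons (h : F.Computes w s x y) (h' : (whileCons F).Computes w t y z) :
    (whileCons F).Computes w (s + t + 1) (.cons :: x) z := fun l =>
  runs_loop_of_goto (by simp [popTo, State.holdsCons, clearBuffer]) (h l) (h' l)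

end Control

/-- If the buffer holds `cons`, push `true` to `main`, otherwise `false`. -/
def pushTest : TM2.Stmt (Stack.Alphabet τ Γ) Unit (State τ σ) :=
  .branch State.holdsCons
    (pushSymbol .main .nil <| pushSymbol .main .nil <| pushSymbol .main .cons <| clearBuffer .halt)
    (pushSymbol .main .nil <| clearBuffer .halt)

theorem stepAux_pushTest (b : Bool) (l : List (Symbol τ)) :
    TM2.stepAux (pushTest (Γ := Γ)) (some (cond b .cons .nil), w) (store (onlyMain l) i o S) =
      ⟨none, (none, w), store (onlyMain (code τ b ++ l)) i o S⟩ := by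
  cases b <;> simp [pushTest, pushSymbol, clearBuffer, State.holdsCons]

/-- Replace the two topmost terms, which are letters `a` and `b`, by `f a b`. -/
def applyLetters (f : τ → τ → Bool) : Program (Stack.Alphabet τ Γ) (State τ σ) :=
  repeatStmt <| popTo .main <| .pop (.reg .main)
    (fun v s => (match v.1, s with
      | some (.atom a), some (.atom b) => some (cond (f a b) .cons .nil)
      | _, _ => none, v.2)) pushTest

theorem computes_applyLetters (f : τ → τ → Bool) (a b : τ) :
    (applyLetters (Γ := Γ) f).Computes w 1 [.atom a, .atom b] (code τ (f a b)) :=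
  computes_repeatStmt fun l => by simp [popTo, stepAux_pushTest]

end Program
end Basic

/-! ## Input, output and calls of a subroutine -/

section Subroutine

variable {τ K : Type} [DecidableEq K] {Γ : K → Type} {Λ σ : Type}

/-- A statement of a subroutine as a statement acting on the whole memory. -/
def liftStmt : TM2.Stmt Γ Λ σ → TM2.Stmt (Stack.Alphabet τ Γ) Λ (State τ σ)
  | .push k g q => .push (.sub k) (fun v => g v.2) (liftStmt q)
  | .peek k g q => .peek (.sub k) (fun v s => (v.1, g v.2 s)) (liftStmt q)
  | .pop k g q => .pop (.sub k) (fun v s => (v.1, g v.2 s)) (liftStmt q)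
  | .load g q => .load (fun v => (v.1, g v.2)) (liftStmt q)
  | .branch g q q' => .branch (fun v => g v.2) (liftStmt q) (liftStmt q')
  | .goto g => .goto fun v => g v.2
  | .halt => .halt

variable (v : Option (Symbol τ)) (R : Reg → List (Symbol τ)) (i : List τ) (o : List Bool)

/-- A configuration of a subroutine as a configuration of the whole machine. -/
def liftCfg (c : TM2.Cfg Γ Λ σ) : TM2.Cfg (Stack.Alphabet τ Γ) Λ (State τ σ) :=
  ⟨c.l, (v, c.var), store R i o c.stk⟩

theorem stepAux_liftStmt (q : TM2.Stmt Γ Λ σ) (w : σ) (S : ∀ k, List (Γ k)) :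
    TM2.stepAux (liftStmt q) (v, w) (store R i o S) = liftCfg v R i o (TM2.stepAux q w S) := by
  induction q generalizing w S with
  | push _ _ _ ih | peek _ _ _ ih | pop _ _ _ ih | load _ _ ih =>
    simp only [liftStmt, TM2.stepAux, update_store_sub, store_sub, ih]
  | branch g q q' ih ih' => cases hg : g w <;> simp [liftStmt, TM2.stepAux, hg, ih, ih']
  | goto => rfl
  | halt => rfl

theorem EvalsWithin.lift {m : Λ → TM2.Stmt Γ Λ σ} {t : ℕ} {c c' : TM2.Cfg Γ Λ σ}
    (h : EvalsWithin (TM2.step m) t c c') :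
    EvalsWithin (TM2.step fun l => liftStmt (m l)) t (liftCfg v R i o c) (liftCfg v R i o c') := by
  refine h.map _ ?_
  rintro ⟨_ | l, w, S⟩ d hd
  · simp only [TM2.step, reduceCtorEq] at hd
  · obtain rfl := Option.some.inj hd
    exact congrArg some (stepAux_liftStmt v R i o (m l) w S)

theorem initList_eq (M : FinTM2) (l : List (M.Γ M.k₀)) :
    initList M l = ⟨some M.main, M.initialState, Function.update (fun _ => []) M.k₀ l⟩ := by
  unfold initList
  congr 1
  funext k
  rcases eq_or_ne k M.k₀ with rfl | h <;> simp [*]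

theorem haltList_eq (M : FinTM2) (l : List (M.Γ M.k₁)) :
    haltList M l = ⟨none, M.initialState, Function.update (fun _ => []) M.k₁ l⟩ := by
  unfold haltList
  congr 1
  funext k
  rcases eq_or_ne k M.k₁ with rfl | h <;> simp [*]

end Subroutine

namespace Program

section InputOutput

variable {τ K : Type} [DecidableEq K] {Γ : K → Type} {σ : Type} (v : Option (Symbol τ)) (w : σ)
  (i : List τ) (o : List Bool) (S : ∀ k, List (Γ k))

/-- Move the letters of a list from `main` to `aux₁`, in reverse order. -/
def unpack : Program (Stack.Alphabet τ Γ) (State τ σ) :=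
  repeatStmt <| popTo .main <| .branch State.holdsCons
    (popTo .main <| pushFrom .aux₁ <| .goto fun _ => ()) (clearBuffer .halt)

theorem runs_unpack (l : List τ) (x y : List (Symbol τ)) :
    unpack.Runs (l.length + 1)
      ((v, w), store (Function.update (onlyMain (code τ l ++ x)) .aux₁ y) i o S)
      ((none, w),
        store (Function.update (onlyMain x) .aux₁ ((l.map .atom).reverse ++ y)) i o S) := by
  induction l generalizing y v with
  | nil => exact runs_repeatStmt_of_halt (by simp [popTo, clearBuffer, State.holdsCons])
  | cons a l ih =>
    refine runs_repeatStmt_of_goto ?_ (by simpa [unpack] using ih (some (.atom a)) (.atom a :: y))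
    simp [popTo, pushFrom, State.holdsCons]

/-- Move the input to `aux₁`, in reverse order. -/
def readInput : Program (Stack.Alphabet τ Γ) (State τ σ) :=
  repeatStmt <| .pop .input (fun v s => (s.map .atom, v.2)) <| .branch (fun v => v.1.isSome)
    (pushFrom .aux₁ <| .goto fun _ => ()) (clearBuffer .halt)

theorem runs_readInput (x y : List (Symbol τ)) :
    readInput.Runs (i.length + 1)
      ((v, w), store (Function.update (onlyMain x) .aux₁ y) i o S)
      ((none, w),
        store (Function.update (onlyMain x) .aux₁ ((i.map .atom).reverse ++ y)) [] o S) := by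
  induction i generalizing y v with
  | nil => exact runs_repeatStmt_of_halt (by simp [clearBuffer])
  | cons a i ih =>
    refine runs_repeatStmt_of_goto ?_
      (by simpa [readInput] using ih (some (.atom a)) (.atom a :: y))
    simp [pushFrom]

/-- Move the letters on `aux₁` to the list on `main`, in reverse order. -/
def pack : Program (Stack.Alphabet τ Γ) (State τ σ) :=
  repeatStmt <| popTo .aux₁ <| .branch (fun v => v.1.isSome)
    (pushFrom .main <| pushSymbol .main .cons <| .goto fun _ => ()) (clearBuffer .halt)

theorem runs_pack (l l' : List τ) :
    pack.Runs (l.length + 1)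
      ((v, w), store (Function.update (onlyMain (code τ l')) .aux₁ (l.map .atom)) i o S)
      ((none, w), store (onlyMain (code τ (l.reverse ++ l'))) i o S) := by
  induction l generalizing l' v with
  | nil => exact runs_repeatStmt_of_halt (by simp [popTo, clearBuffer])
  | cons a l ih =>
    refine runs_repeatStmt_of_goto ?_ (by simpa [pack] using ih (some (.atom a)) (a :: l'))
    simp [popTo, pushFrom, pushSymbol]

/-- Convert the input to a list on `main`. -/
def loadInput : Program (Stack.Alphabet τ Γ) (State τ σ) :=
  readInput.seq ((repeatStmt (pushSymbol .main .nil .halt)).seq pack)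

theorem runs_loadInput :
    loadInput.Runs (2 * i.length + 3) ((none, w), store (onlyMain []) i o S)
      ((none, w), store (onlyMain (code τ i)) [] o S) := by
  have hread := runs_readInput none w i o S [] []
  have hpack := runs_pack none w [] o S i.reverse []
  simp only [List.append_nil, List.reverse_reverse, List.length_reverse, ne_eq, reduceCtorEq,
    not_false_eq_true, update_onlyMain_nil] at hread hpack
  refine (hread.seq (Runs.seq (runs_repeatStmt_of_halt ?_) hpack)).mono (by omega)
  simp [pushSymbol]

/-- Move a truth value from `main` to the output. -/
def storeOutput : Program (Stack.Alphabet τ Γ) (State τ σ) :=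
  repeatStmt <| popTo .main <| .branch State.holdsCons
    (popTo .main <| popTo .main <| .push .output (fun _ => true) <| clearBuffer .halt)
    (.push .output (fun _ => false) <| clearBuffer .halt)

theorem runs_storeOutput (b : Bool) :
    storeOutput.Runs 1 ((none, w), store (onlyMain (code τ b)) i [] S)
      ((none, w), store (onlyMain []) i [b] S) := by
  cases b <;>
    exact runs_repeatStmt_of_halt (by simp [popTo, clearBuffer, State.holdsCons, store])

end InputOutput

end Program

section Oracle

variable {τ : Type} (O : TM2ComputableAux τ Bool)

/-- Programs that may use the machine `O` as a subroutine. -/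
abbrev OracleProgram : Type 1 := Program (Stack.Alphabet τ O.tm.Γ) (State τ O.tm.σ)

namespace Program

/-- Move the letters on `aux₁` to the input stack of the subroutine, in reverse order. -/
def feed [Inhabited τ] : OracleProgram O :=
  repeatStmt <| popTo .aux₁ <| .branch (fun v => v.1.isSome)
    (.push (.sub O.tm.k₀) (fun v => O.inputAlphabet.symm
      (match v.1 with
        | some (.atom a) => a
        | _ => default)) <| .goto fun _ => ()) (clearBuffer .halt)

theorem runs_feed [Inhabited τ] (l l' : List τ) (x : List (Symbol τ))
    (v : Option (Symbol τ)) (w : O.tm.σ) :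
    (feed O).Runs (l.length + 1)
      ((v, w), store (Function.update (onlyMain x) .aux₁ (l.map .atom)) [] []
        (Function.update (fun _ => []) O.tm.k₀ (l'.map O.inputAlphabet.symm)))
      ((none, w), store (onlyMain x) [] []
        (Function.update (fun _ => []) O.tm.k₀ ((l.reverse ++ l').map O.inputAlphabet.symm))) := by
  induction l generalizing l' v with
  | nil => exact runs_repeatStmt_of_halt (by simp [popTo, clearBuffer])
  | cons a l ih =>
    refine runs_repeatStmt_of_goto ?_ (by simpa [feed] using ih (a :: l') (some (.atom a)))
    simp [popTo]

/-- The machine `O` as a program acting on its own stacks and its part of the internal state. -/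
def subroutine : OracleProgram O :=
  ⟨O.tm.Λ, O.tm.ΛFin, O.tm.main, fun l => liftStmt (O.tm.m l)⟩

theorem runs_subroutine {l : List (O.tm.Γ O.tm.k₀)} {l' : List (O.tm.Γ O.tm.k₁)} {t : ℕ}
    (h : TM2OutputsInTime O.tm l (some l') t) (R : Reg → List (Symbol τ)) :
    (subroutine O).Runs t
      ((none, O.tm.initialState), store R [] [] (Function.update (fun _ => []) O.tm.k₀ l))
      ((none, O.tm.initialState), store R [] [] (Function.update (fun _ => []) O.tm.k₁ l')) := by
  have h' : EvalsWithin O.tm.step t (initList O.tm l) (haltList O.tm l') := ⟨h⟩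
  rw [initList_eq, haltList_eq] at h'
  exact h'.lift none R [] []

/-- Move the output of the subroutine to `main`. -/
def fetch : OracleProgram O :=
  repeatStmt <| .pop (.sub O.tm.k₁)
    (fun v s => (s.map fun s => cond (O.outputAlphabet s) .cons .nil, v.2)) pushTest

theorem runs_fetch (b : Bool) (x : List (Symbol τ)) (w : O.tm.σ) :
    (fetch O).Runs 1
      ((none, w), store (onlyMain x) [] []
        (Function.update (fun _ => []) O.tm.k₁ [O.outputAlphabet.symm b]))
      (atRest w (onlyMain (code τ b ++ x))) :=
  runs_repeatStmt_of_halt (by simp [stepAux_pushTest])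

/-- Replace a list of letters by the answer of the subroutine. -/
def call [Inhabited τ] : OracleProgram O := unpack.seq ((feed O).seq ((subroutine O).seq (fetch O)))

theorem computes_call [Inhabited τ] {l : List τ} {b : Bool} {t : ℕ}
    (h : TM2OutputsInTime O.tm (l.map O.inputAlphabet.symm)
      (some [O.outputAlphabet.symm b]) t) :
    (call O).Computes O.tm.initialState (2 * l.length + t + 3) (code τ l) (code τ b) := fun x => by
  have hunpack := runs_unpack none O.tm.initialState [] [] (fun k => ([] : List (O.tm.Γ k))) l x []
  have hfeed := runs_feed O l.reverse [] x none O.tm.initialState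
  simp only [List.append_nil, List.reverse_reverse, List.length_reverse, List.map_nil, ne_eq,
    reduceCtorEq, not_false_eq_true, update_onlyMain_nil, Function.update_eq_self,
    List.map_reverse] at hunpack hfeed
  exact (hunpack.seq (hfeed.seq ((runs_subroutine O h _).seq (runs_fetch O b x _)))).mono
    (by omega)

end Program

end Oracle

/-! ## Functions computable in polynomial time -/

section Size

variable (τ : Type) {A B : Type}

/-- The size of the representation of `a`. -/
def size [ToSexp τ A] (a : A) : ℕ := (code τ a).length

@[simp] theorem size_atom (a : τ) : size τ a = 1 := rfl

@[simp] theorem size_true : size τ true = 3 := rfl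

@[simp] theorem size_false : size τ false = 1 := rfl

theorem size_bool_le (b : Bool) : size τ b ≤ 3 := by cases b <;> simp

variable [ToSexp τ A] [ToSexp τ B]

@[simp] theorem size_prod (x : A × B) : size τ x = size τ x.1 + size τ x.2 + 1 := by simp [size]

@[simp] theorem size_nil : size τ ([] : List A) = 1 := rfl

@[simp] theorem size_cons (a : A) (l : List A) : size τ (a :: l) = size τ a + size τ l + 1 := by
  simp [size]

@[simp] theorem size_none : size τ (none : Option A) = 1 := rfl

@[simp] theorem size_some (a : A) : size τ (some a) = size τ a + 2 := by simp [size]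

theorem length_lt_size (l : List A) : l.length < size τ l := by
  induction l with
  | nil => simp
  | cons a l ih => simp only [List.length_cons, size_cons]; omega

variable {τ} in
theorem size_lt_of_mem {a : A} {l : List A} (h : a ∈ l) : size τ a < size τ l := by
  induction h with
  | head => simp only [size_cons]; omega
  | tail _ _ ih => simp only [size_cons]; omega

theorem size_append (l l' : List A) : size τ (l ++ l') + 1 = size τ l + size τ l' := by
  induction l with
  | nil => simp only [List.nil_append, size_nil]; omega
  | cons a l ih => simp only [List.cons_append, size_cons]; omega

theorem size_le_of_prefix {l l' : List A} (h : l <+: l') : size τ l ≤ size τ l' := by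
  obtain ⟨l'', rfl⟩ := h
  have happend := size_append τ l l''
  have hpos := length_lt_size τ l''
  omega

variable {τ} in
theorem size_letters (l : List τ) : size τ l = 2 * l.length + 1 := by
  induction l with
  | nil => rfl
  | cons a l ih => simp only [size_cons, size_atom, ih, List.length_cons]; omega

end Size

theorem monotone_eval (p : Polynomial ℕ) : Monotone fun n => p.eval n := fun m n h => by
  simp only [Polynomial.eval_eq_sum_range]
  gcongr

/-- Computability in polynomial time, on the representations by S-expressions, by a program that may
use `O` as a subroutine. The polynomial also bounds the sizes of the values, so that compositions
need no bound on the growth of the stacks in terms of the time. -/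
def PolyTime {τ A B : Type} [ToSexp τ A] [ToSexp τ B] (O : TM2ComputableAux τ Bool)
    (f : A → B) : Prop :=
  ∃ (F : OracleProgram O) (p : Polynomial ℕ), ∀ a, size τ (f a) ≤ p.eval (size τ a) ∧
    F.Computes O.tm.initialState (p.eval (size τ a)) (code τ a) (code τ (f a))

namespace PolyTime

open Program

variable {τ A B C D : Type} [ToSexp τ A] [ToSexp τ B] [ToSexp τ C] [ToSexp τ D]
  {O : TM2ComputableAux τ Bool}

/-! ### Composition, pairs and case distinctions -/

theorem of_computes {f : A → B} (F : OracleProgram O) (p q : Polynomial ℕ)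
    (hp : ∀ a, size τ (f a) ≤ p.eval (size τ a))
    (hq : ∀ a, F.Computes O.tm.initialState (q.eval (size τ a)) (code τ a) (code τ (f a))) :
    PolyTime O f :=
  ⟨F, p + q, fun a => ⟨by rw [Polynomial.eval_add]; exact (hp a).trans (Nat.le_add_right _ _),
    (hq a).mono (by rw [Polynomial.eval_add]; exact Nat.le_add_left _ _)⟩⟩

theorem computes_dup_code (a : A) : (dup : OracleProgram O).Computes O.tm.initialState
    (4 * size τ a + 5) (code τ a) (code τ a ++ code τ a) := computes_dup _

theorem computes_swap_code (a : A) (b : B) : (swap : OracleProgram O).Computes O.tm.initialState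
    (2 * size τ a + 2 * size τ b + 6) (code τ a ++ code τ b) (code τ b ++ code τ a) :=
  computes_swap _ _

theorem computes_drop_code (a : A) : (drop : OracleProgram O).Computes O.tm.initialState
    (2 * size τ a + 3) (code τ a) [] := computes_drop _

theorem computes_rotate_code (a : A) (b : B) (c : C) :
    (rotate : OracleProgram O).Computes O.tm.initialState
      (2 * size τ a + 2 * size τ b + 2 * size τ c + 9) (code τ a ++ (code τ b ++ code τ c))
      (code τ a ++ (code τ c ++ code τ b)) := computes_rotate _ _ _

theorem congr {f g : A → B} (h : PolyTime O f) (hfg : ∀ a, f a = g a) : PolyTime O g :=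
  (funext hfg : f = g) ▸ h

theorem comp {g : B → C} {f : A → B} (hg : PolyTime O g) (hf : PolyTime O f) :
    PolyTime O fun a => g (f a) := by
  obtain ⟨F, p, hF⟩ := hf
  obtain ⟨G, q, hG⟩ := hg
  refine of_computes (F.seq G) (q.comp p) (p + q.comp p) (fun a => ?_) fun a => ?_
  · rw [Polynomial.eval_comp]
    exact (hG _).1.trans (monotone_eval q (hF a).1)
  · rw [Polynomial.eval_add, Polynomial.eval_comp]
    exact (hF a).2.seq ((hG _).2.mono (monotone_eval q (hF a).1))

theorem of_toSexp_eq {g : B → C} (hg : PolyTime O g) {f : A → D} (i : A → B)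
    (hi : ∀ a, (ToSexp.toSexp a : Sexp τ) = ToSexp.toSexp (i a))
    (ho : ∀ a, (ToSexp.toSexp (f a) : Sexp τ) = ToSexp.toSexp (g (i a))) : PolyTime O f := by
  obtain ⟨F, p, hF⟩ := hg
  refine ⟨F, p, fun a => ?_⟩
  have hFa := hF (i a)
  simp only [size, code] at hFa ⊢
  rwa [hi, ho]

theorem id : PolyTime O fun a : A => a :=
  ⟨repeatStmt .halt, Polynomial.X + 1, fun _ =>
    ⟨by simp, (computes_repeatStmt fun _ => rfl).mono (by simp)⟩⟩

theorem of_toSexp_eq_self {f : A → B} (h : ∀ a, (ToSexp.toSexp (f a) : Sexp τ) = ToSexp.toSexp a) :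
    PolyTime O f :=
  (id (A := A)).of_toSexp_eq (fun a => a) (fun _ => rfl) h

theorem const (b : B) : PolyTime O fun _ : A => b := by
  refine of_computes (drop.seq (pushConst (code τ b))) (Polynomial.C (size τ b))
    (2 * Polynomial.X + 4) (fun a => by simp) fun a => ?_
  exact ((computes_drop_code a).seq (computes_pushConst _)).mono (by simp)

theorem fst : PolyTime O fun x : A × B => x.1 := by
  refine of_computes (pop.seq (swap.seq drop)) Polynomial.X (4 * Polynomial.X + 20)
    (fun x => by simp only [size_prod, Polynomial.eval_X]; omega) fun x => ?_
  refine ((computes_pop _ _).seq ((computes_swap_code x.1 x.2).seq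
    ((computes_drop_code x.2).append _))).mono ?_
  simp only [size_prod, Polynomial.eval_add, Polynomial.eval_mul, Polynomial.eval_ofNat,
    Polynomial.eval_X]
  omega

theorem snd : PolyTime O fun x : A × B => x.2 := by
  refine of_computes (pop.seq drop) Polynomial.X (4 * Polynomial.X + 20)
    (fun x => by simp only [size_prod, Polynomial.eval_X]; omega) fun x => ?_
  refine ((computes_pop _ _).seq ((computes_drop_code x.1).append _)).mono ?_
  simp only [size_prod, Polynomial.eval_add, Polynomial.eval_mul, Polynomial.eval_ofNat,
    Polynomial.eval_X]
  omega

theorem pair {f : A → B} {g : A → C} (hf : PolyTime O f) (hg : PolyTime O g) :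
    PolyTime O fun a => (f a, g a) := by
  obtain ⟨F, p, hF⟩ := hf
  obtain ⟨G, q, hG⟩ := hg
  refine of_computes (dup.seq (F.seq (swap.seq (G.seq (swap.seq pushCons))))) (p + q + 1)
    (6 * Polynomial.X + 5 * p + 3 * q + 20) (fun a => ?_) fun a => ?_
  · simpa using Nat.add_le_add (hF a).1 (hG a).1
  · have hfa := (hF a).1
    have hga := (hG a).1
    refine ((computes_dup_code a).seq (((hF a).2.append _).seq
      ((computes_swap_code (f a) a).seq (((hG a).2.append _).seq
        ((computes_swap_code (g a) (f a)).seq (computes_pushCons _)))))).mono ?_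
    simp only [Polynomial.eval_add, Polynomial.eval_mul, Polynomial.eval_ofNat,
      Polynomial.eval_X] at hfa hga ⊢
    omega

theorem ite {c : A → Bool} {f g : A → B} (hc : PolyTime O c) (hf : PolyTime O f)
    (hg : PolyTime O g) : PolyTime O fun a => if c a then f a else g a := by
  obtain ⟨Fc, r, hFc⟩ := hc
  obtain ⟨F, p, hF⟩ := hf
  obtain ⟨G, q, hG⟩ := hg
  refine of_computes (dup.seq (Fc.seq (caseCons (pop.seq (pop.seq F)) G))) (p + q)
    (4 * Polynomial.X + r + p + q + 20) (fun a => ?_) fun a => ?_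
  · have hfa := (hF a).1
    have hga := (hG a).1
    rw [Polynomial.eval_add]
    split_ifs <;> omega
  · have hbranch : (caseCons (pop.seq (pop.seq F)) G).Computes O.tm.initialState
        (p.eval (size τ a) + q.eval (size τ a) + 3) (code τ (c a) ++ code τ a)
        (code τ (if c a then f a else g a)) := by
      cases hca : c a
      · exact (computes_caseCons_nil (hG a).2).mono (by omega)
      · exact (computes_caseCons_cons ((computes_pop _ _).seq
          ((computes_pop _ _).seq (hF a).2))).mono (by omega)
    refine ((computes_dup_code a).seq (((hFc a).2.append _).seq hbranch)).mono ?_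
    simp only [Polynomial.eval_add, Polynomial.eval_mul, Polynomial.eval_ofNat, Polynomial.eval_X]
    omega

theorem computes_caseCons_list {F G : OracleProgram O} {f : A → C} {g : (B × List B) × A → C}
    {p q : Polynomial ℕ} {n : ℕ} {l : List B} {a : A}
    (hF : F.Computes O.tm.initialState (p.eval (size τ a)) (code τ a) (code τ (f a)))
    (hG : ∀ y, G.Computes O.tm.initialState (q.eval (size τ y)) (code τ y) (code τ (g y)))
    (hl : size τ l ≤ n) :
    (caseCons (pushCons.seq (pushCons.seq G)) F).Computes O.tm.initialState
      (p.eval (size τ a) + q.eval (n + size τ a + 1) + 3) (code τ l ++ code τ a)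
      (code τ (match l with
        | [] => f a
        | b :: bs => g ((b, bs), a))) := by
  cases l with
  | nil => exact (computes_caseCons_nil hF).mono (by omega)
  | cons b bs =>
    have htime : q.eval (size τ ((b, bs), a)) ≤ q.eval (n + size τ a + 1) :=
      monotone_eval q (by simp only [size_cons, size_prod] at hl ⊢; omega)
    have hcons := hG ((b, bs), a)
    simp only [code_prod, List.cons_append, List.append_assoc] at hcons
    rw [code_cons, List.cons_append, List.append_assoc]
    exact (computes_caseCons_cons ((computes_pushCons _).seq
      ((computes_pushCons _).seq hcons))).mono (by omega)

theorem listCase {l : A → List B} {f : A → C} {g : (B × List B) × A → C} (hl : PolyTime O l)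
    (hf : PolyTime O f) (hg : PolyTime O g) :
    PolyTime O fun a => match l a with
      | [] => f a
      | b :: bs => g ((b, bs), a) := by
  obtain ⟨L, r, hL⟩ := hl
  obtain ⟨F, p, hF⟩ := hf
  obtain ⟨G, q, hG⟩ := hg
  refine of_computes (dup.seq (L.seq (caseCons (pushCons.seq (pushCons.seq G)) F)))
    (p + q.comp (r + Polynomial.X + 1))
    (4 * Polynomial.X + r + p + q.comp (r + Polynomial.X + 1) + 20) (fun a => ?_) fun a => ?_
  · have hla := (hL a).1
    simp only [Polynomial.eval_add, Polynomial.eval_comp, Polynomial.eval_X, Polynomial.eval_one]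
    rcases hl : l a with _ | ⟨b, bs⟩
    · exact (hF a).1.trans (Nat.le_add_right _ _)
    · refine ((hG ((b, bs), a)).1.trans (monotone_eval q ?_)).trans (Nat.le_add_left _ _)
      rw [hl] at hla
      simp only [size_cons, size_prod] at hla ⊢; omega
  · refine ((computes_dup_code a).seq (((hL a).2.append _).seq
      (computes_caseCons_list (hF a).2 (fun y => (hG y).2) (hL a).1))).mono ?_
    simp only [Polynomial.eval_add, Polynomial.eval_mul, Polynomial.eval_ofNat, Polynomial.eval_X,
      Polynomial.eval_comp, Polynomial.eval_one]
    omega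

theorem letters (f : τ → τ → Bool) : PolyTime O fun x : τ × τ => f x.1 x.2 :=
  of_computes (pop.seq (applyLetters f)) 3 2 (fun _ => by simpa using size_bool_le τ _) fun x =>
    ((computes_pop _ _).seq (computes_applyLetters f x.1 x.2)).mono (by simp)

theorem oracle [Inhabited τ] {f : A → Bool} (p : Polynomial ℕ) (e : A → List τ)
    (he : ∀ a, code τ a = code τ (e a))
    (h : ∀ a, TM2OutputsInTime O.tm ((e a).map O.inputAlphabet.symm)
      (some [O.outputAlphabet.symm (f a)]) (p.eval (e a).length)) : PolyTime O f := by
  refine of_computes (call O) 3 (2 * Polynomial.X + p + 3)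
    (fun a => by simpa using size_bool_le τ _) fun a => ?_
  have hsize : size τ a = 2 * (e a).length + 1 := (congrArg _ (he a)).trans (size_letters _)
  have htime : p.eval (e a).length ≤ p.eval (size τ a) := monotone_eval p (by omega)
  rw [he]
  refine (computes_call O (h a)).mono ?_
  simp only [Polynomial.eval_add, Polynomial.eval_mul, Polynomial.eval_ofNat, Polynomial.eval_X]
  omega

/-! ### Iteration over a list -/

theorem computes_foldl {f : A × B → B} {F : OracleProgram O} {p : Polynomial ℕ}
    (hF : ∀ x, F.Computes O.tm.initialState (p.eval (size τ x)) (code τ x) (code τ (f x)))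
    (n N : ℕ) (l : List A) (b : B) (hn : size τ l ≤ n)
    (hN : ∀ l', l' <+: l → size τ (l'.foldl (fun b a => f (a, b)) b) ≤ N) :
    (whileCons (rotate.seq (pushCons.seq (F.seq swap)))).Computes O.tm.initialState
      (l.length * (4 * n + 4 * N + 20 + p.eval (n + N + 1)) + 1) (code τ l ++ code τ b)
      (code τ (l.foldl (fun b a => f (a, b)) b)) := by
  induction l generalizing b with
  | nil => exact (computes_whileCons_nil _).mono (by simp)
  | cons a l ih =>
    have hb : size τ b ≤ N := by simpa using hN [] (by simp)
    have hfb : size τ (f (a, b)) ≤ N := by simpa using hN [a] (by simp)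
    have htime : p.eval (size τ (a, b)) ≤ p.eval (n + N + 1) :=
      monotone_eval p (by simp only [size_cons, size_prod] at hn ⊢; omega)
    have hrest := ih (f (a, b)) (by simp only [size_cons] at hn; omega) fun l' hl' => by
      simpa using hN (a :: l') (by simpa using hl')
    have hF' : F.Computes O.tm.initialState (p.eval (size τ (a, b)))
        (.cons :: (code τ a ++ (code τ b ++ code τ l))) (code τ (f (a, b)) ++ code τ l) := by
      simpa using (hF (a, b)).append (code τ l)
    have hbody := (computes_rotate_code (O := O) a l b).seq ((computes_pushCons _).seq
      (hF'.seq (computes_swap_code (f (a, b)) l)))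
    rw [code_cons]
    refine Computes.mono (by simpa using computes_whileCons_cons hbody hrest) ?_
    simp only [List.length_cons, Nat.succ_mul]
    simp only [size_cons, size_prod] at hn hb hfb htime ⊢
    omega

theorem foldl {f : A × B → B} (hf : PolyTime O f) (q : Polynomial ℕ)
    (hq : ∀ (l : List A) (b : B),
      size τ (l.foldl (fun b a => f (a, b)) b) ≤ q.eval (size τ l + size τ b)) :
    PolyTime O fun x : List A × B => x.1.foldl (fun b a => f (a, b)) x.2 := by
  obtain ⟨F, p, hF⟩ := hf
  refine of_computes (pop.seq (whileCons (rotate.seq (pushCons.seq (F.seq swap))))) q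
    (Polynomial.X * (4 * Polynomial.X + 4 * q + 20 + p.comp (Polynomial.X + q + 1)) + 2)
    (fun x => (hq _ _).trans (monotone_eval q (by simp))) fun x => ?_
  have hfold := computes_foldl (fun x => (hF x).2) (size τ x) (q.eval (size τ x)) x.1 x.2
    (by simp only [size_prod]; omega) fun l' hl' => (hq l' x.2).trans (monotone_eval q (by
      have hle := size_le_of_prefix τ hl'
      simp only [size_prod]; omega))
  refine ((computes_pop _ _).seq hfold).mono ?_
  have hlength : x.1.length ≤ size τ x := by
    have hlt := length_lt_size τ x.1
    simp only [size_prod]; omega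
  have hmul := Nat.mul_le_mul_right (4 * size τ x + 4 * q.eval (size τ x) + 20 +
    p.eval (size τ x + q.eval (size τ x) + 1)) hlength
  simp only [Polynomial.eval_add, Polynomial.eval_mul, Polynomial.eval_comp, Polynomial.eval_X,
    Polynomial.eval_one, Polynomial.eval_ofNat]
  omega

theorem foldl_prodMk {A B C : Type*} (f : A × B × C → C) (l : List A) (b : B) (c : C) :
    l.foldl (fun (x : B × C) a => (x.1, f (a, x))) (b, c) =
      (b, l.foldl (fun c a => f (a, b, c)) c) := by
  induction l generalizing c with
  | nil => rfl
  | cons a _ ih => exact ih _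

theorem size_foldl_le {f : A × B × C → C} {q : Polynomial ℕ}
    (hq : ∀ a b c, size τ (f (a, b, c)) ≤ size τ c + q.eval (size τ a + size τ b))
    (l : List A) (b : B) (c : C) {n : ℕ} (hn : size τ l + size τ b ≤ n) :
    size τ (l.foldl (fun c a => f (a, b, c)) c) ≤ size τ c + l.length * q.eval n := by
  induction l generalizing c with
  | nil => simp
  | cons a l ih =>
    have hstep := hq a b c
    rw [size_cons] at hn
    have hle : q.eval (size τ a + size τ b) ≤ q.eval n := monotone_eval q (by omega)
    have hrest := ih (f (a, b, c)) (by omega)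
    simp only [List.foldl_cons, List.length_cons, Nat.succ_mul]
    omega

theorem foldl_param {f : A × B × C → C} (hf : PolyTime O f) (q : Polynomial ℕ)
    (hq : ∀ a b c, size τ (f (a, b, c)) ≤ size τ c + q.eval (size τ a + size τ b)) :
    PolyTime O fun x : List A × B × C => x.1.foldl (fun c a => f (a, x.2.1, c)) x.2.2 := by
  have hfold := foldl (O := O) (f := fun x : A × B × C => (x.2.1, f x)) ((fst.comp snd).pair hf)
    (Polynomial.X + Polynomial.X * q) ?_
  · exact (snd.comp hfold).congr fun x => congrArg Prod.snd (foldl_prodMk f x.1 x.2.1 x.2.2)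
  · rintro l ⟨b, c⟩
    have hsize := size_foldl_le hq l b c (n := size τ l + size τ (b, c)) (by
      simp only [size_prod]; omega)
    have hlength : l.length * q.eval (size τ l + size τ (b, c)) ≤
        (size τ l + size τ (b, c)) * q.eval (size τ l + size τ (b, c)) :=
      Nat.mul_le_mul_right _ ((length_lt_size τ l).le.trans (Nat.le_add_right _ _))
    have hprod := size_prod τ (b, c)
    simp only [foldl_prodMk, Polynomial.eval_add, Polynomial.eval_mul, Polynomial.eval_X]
    rw [size_prod]
    dsimp only at hprod ⊢
    omega

theorem foldl_of_size_le {f : A × B → B} (hf : PolyTime O f) (q : Polynomial ℕ)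
    (hq : ∀ a b, size τ (f (a, b)) ≤ size τ b + q.eval (size τ a)) :
    PolyTime O fun x : List A × B => x.1.foldl (fun b a => f (a, b)) x.2 :=
  (foldl_param (B := Bool) (f := fun x => f (x.1, x.2.2)) (hf.comp (fst.pair (snd.comp snd))) q
    fun a _ b => (hq a b).trans (Nat.add_le_add_left
      (monotone_eval q (Nat.le_add_right _ _)) _)).comp (fst.pair ((const true).pair snd))

/-! ### Operations on lists and truth values -/

theorem cons {f : A → B} {g : A → List B} (hf : PolyTime O f) (hg : PolyTime O g) :
    PolyTime O fun a => f a :: g a :=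
  (of_toSexp_eq_self (f := fun x : B × List B => x.1 :: x.2) fun _ => rfl).comp (hf.pair hg)

theorem some {f : A → B} (hf : PolyTime O f) : PolyTime O fun a => Option.some (f a) :=
  (hf.cons (const [])).of_toSexp_eq (fun a => a) (fun _ => rfl) fun _ => rfl

theorem toList : PolyTime O fun o : Option A => o.toList :=
  of_toSexp_eq_self fun o => by cases o <;> rfl

theorem optionCase {o : A → Option B} {f : A → C} {g : B × A → C} (ho : PolyTime O o)
    (hf : PolyTime O f) (hg : PolyTime O g) :
    PolyTime O fun a => match o a with
      | none => f a
      | Option.some b => g (b, a) :=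
  (listCase (l := fun a => (o a).toList) (g := fun z => g (z.1.1, z.2)) (toList.comp ho) hf
    (hg.comp ((fst.comp fst).pair snd))).congr fun a => by cases o a <;> rfl

theorem isEmpty : PolyTime O fun l : List A => l.isEmpty :=
  (listCase (f := fun _ : List A => true) (g := fun _ : (A × List A) × List A => false)
    id (const true) (const false)).congr fun l => by cases l <;> rfl

theorem tail : PolyTime O fun l : List A => l.tail :=
  (listCase (f := fun _ : List A => ([] : List A)) (g := fun x : (A × List A) × List A => x.1.2)
    id (const []) (snd.comp fst)).congr fun l => by cases l <;> rfl

theorem and {f g : A → Bool} (hf : PolyTime O f) (hg : PolyTime O g) :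
    PolyTime O fun a => f a && g a :=
  (hf.ite hg (const false)).congr fun a => by cases f a <;> rfl

theorem letter (f : τ → Bool) : PolyTime O f := (letters fun a _ => f a).comp (id.pair id)

theorem reverseAppend : PolyTime O fun x : List A × List A => x.1.reverse ++ x.2 :=
  (foldl_of_size_le (f := fun y : A × List A => y.1 :: y.2) (of_toSexp_eq_self fun _ => rfl)
    (Polynomial.X + 1) fun a l => by
      simp only [size_cons, Polynomial.eval_add, Polynomial.eval_X, Polynomial.eval_one]
      omega).congr fun x => by simp

theorem reverse : PolyTime O fun l : List A => l.reverse :=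
  (reverseAppend.comp (id.pair (const []))).congr fun l => by simp

theorem append {f g : A → List B} (hf : PolyTime O f) (hg : PolyTime O g) :
    PolyTime O fun a => f a ++ g a :=
  (reverseAppend.comp ((reverse.comp hf).pair hg)).congr fun a => by simp

theorem foldr_eq_find? {A : Type*} (c : A → Bool) (l : List A) :
    l.foldr (fun a o => if c a then Option.some a else o) none = l.find? c := by
  induction l with
  | nil => rfl
  | cons a l ih => cases hc : c a <;> simp [hc, ih]

theorem find? {c : A × B → Bool} (hc : PolyTime O c) :
    PolyTime O fun x : List A × B => x.1.find? fun a => c (a, x.2) :=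
  ((foldl_param (f := fun y : A × B × Option A => if c (y.1, y.2.1) then Option.some y.1 else y.2.2)
    ((hc.comp (fst.pair (fst.comp snd))).ite fst.some (snd.comp snd)) (Polynomial.X + 2)
    fun a b o => by
      split_ifs
      · simp only [size_some, Polynomial.eval_add, Polynomial.eval_X, Polynomial.eval_ofNat]; omega
      · exact Nat.le_add_right _ _).comp
    ((reverse.comp fst).pair (snd.pair (const none)))).congr fun x => by
      rw [List.foldl_reverse, ← foldr_eq_find?]

theorem any {c : A × B → Bool} (hc : PolyTime O c) :
    PolyTime O fun x : List A × B => x.1.any fun a => c (a, x.2) :=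
  ((find? hc).optionCase (const false) (const true)).congr fun x => by
    rw [← List.isSome_find?]
    cases x.1.find? fun a => c (a, x.2) <;> rfl

end PolyTime

section EqLetters

variable {τ : Type} [DecidableEq τ]

/-- One step of the comparison of a list with a list of letters `y.2.1`: its head is compared with
the letter `y.1`, and the truth value accumulates the results. -/
def compareHead (y : τ × List τ × Bool) : List τ × Bool :=
  match y.2.1 with
  | [] => ([], false)
  | b :: bs => (bs, y.2.2 && decide (y.1 = b))

theorem foldl_compareHead (l l' : List τ) (c : Bool) :
    let r := l.foldl (fun s a => compareHead (a, s)) (l', c)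
    (r.2 && r.1.isEmpty) = true ↔ c = true ∧ l = l' := by
  induction l generalizing l' c with
  | nil => cases l' <;> simp
  | cons a l ih =>
    dsimp only at ih ⊢
    rw [List.foldl_cons, ih]
    cases l' <;> simp [compareHead, and_assoc]

variable {O : TM2ComputableAux τ Bool}

theorem size_compareHead_le (a : τ) (s : List τ × Bool) :
    size τ (compareHead (a, s)) ≤ size τ s + 3 := by
  rcases s with ⟨_ | ⟨b, l⟩, c⟩
  · simp [compareHead]
  · have hbool := size_bool_le τ (c && decide (a = b))
    simp only [compareHead, size_prod, size_cons, size_atom] at hbool ⊢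
    omega

open PolyTime

theorem PolyTime.compareHead : PolyTime O (compareHead (τ := τ)) :=
  (listCase (l := fun y : τ × List τ × Bool => y.2.1)
    (f := fun _ => (([], false) : List τ × Bool))
    (g := fun z => (z.1.2, z.2.2.2 && decide (z.2.1 = z.1.1)))
    (fst.comp snd) (const _) ((snd.comp fst).pair (((snd.comp snd).comp snd).and
      ((letters fun a b => decide (a = b)).comp
        ((fst.comp snd).pair (fst.comp fst)))))).congr fun ⟨_, l, _⟩ => by cases l <;> rfl

theorem PolyTime.eq : PolyTime O fun x : List τ × List τ => decide (x.1 = x.2) := by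
  have hfold := (foldl_of_size_le PolyTime.compareHead 3
    fun a s => (size_compareHead_le a s).trans (by simp)).comp
    (fst.pair (snd.pair (const true)) : PolyTime O fun x : List τ × List τ => (x.1, x.2, true))
  refine ((snd.comp hfold).and (isEmpty.comp (fst.comp hfold))).congr fun x => ?_
  rw [Bool.eq_iff_iff]
  exact (foldl_compareHead x.1 x.2 true).trans (by simp)

end EqLetters

section Machine

variable {τ : Type} {O : TM2ComputableAux τ Bool}

/-- The stack machine that runs a program on a list of letters and outputs the resulting truth
value. -/
def OracleProgram.toMachine (F : OracleProgram O) : TM2ComputableAux τ Bool :=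
  let F' : OracleProgram O := Program.loadInput.seq (F.seq Program.storeOutput)
  { tm :=
      { K := Stack O.tm.K
        kFin := let _ := O.tm.kFin; inferInstance
        k₀ := .input
        k₁ := .output
        Γ := Stack.Alphabet τ O.tm.Γ
        Λ := F'.Λ
        main := F'.start
        ΛFin := F'.fintype
        σ := State τ O.tm.σ
        initialState := (none, O.tm.initialState)
        σFin :=
          let _ : Fintype τ := let _ := O.tm.Γk₀Fin; Fintype.ofEquiv _ O.inputAlphabet
          let _ := O.tm.σFin
          inferInstance
        Γk₀Fin := let _ := O.tm.Γk₀Fin; Fintype.ofEquiv _ O.inputAlphabet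
        m := F'.stmt }
    inputAlphabet := Equiv.refl τ
    outputAlphabet := Equiv.refl Bool }

variable (F : OracleProgram O)

theorem initList_toMachine (l : List τ) : initList F.toMachine.tm l = ⟨some F.toMachine.tm.main,
    (none, O.tm.initialState), store (onlyMain []) l [] fun _ => []⟩ := by
  unfold initList
  congr 1
  funext k
  rcases k with (_ | _ | _ | _ | _) | _ | _ | _ <;> rfl

theorem haltList_toMachine (b : Bool) : haltList F.toMachine.tm [b] = ⟨none,
    (none, O.tm.initialState), store (onlyMain []) [] [b] fun _ => []⟩ := by
  unfold haltList
  congr 1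
  funext k
  rcases k with (_ | _ | _ | _ | _) | _ | _ | _ <;> rfl

variable {F} in
theorem evalsWithin_toMachine {l : List τ} {b : Bool} {t : ℕ}
    (h : F.Computes O.tm.initialState t (code τ l) (code τ b)) :
    EvalsWithin F.toMachine.tm.step (2 * l.length + 4 + t) (initList F.toMachine.tm l)
      (haltList F.toMachine.tm [b]) := by
  have hload := Program.runs_loadInput O.tm.initialState l [] fun k => ([] : List (O.tm.Γ k))
  have hcompute := h []
  have hstore := Program.runs_storeOutput O.tm.initialState ([] : List τ)
    (fun k => ([] : List (O.tm.Γ k))) b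
  simp only [List.append_nil] at hcompute
  rw [initList_toMachine, haltList_toMachine]
  exact (hload.seq (hcompute.seq hstore)).mono (by omega)

theorem PolyTime.inPTime {A : Type} [ToSexp τ A] {f : A → Bool} (h : PolyTime O f)
    (e : A → List τ) (he : ∀ a, code τ a = code τ (e a)) {P : A → Prop}
    (hP : ∀ a, f a = true ↔ P a) : InPTime e P := by
  classical
  obtain ⟨F, p, hF⟩ := h
  have heval (a : A) : EvalsWithin F.toMachine.tm.step
      ((2 * Polynomial.X + 4 + p.comp (2 * Polynomial.X + 1)).eval (e a).length)
      (initList F.toMachine.tm (e a)) (haltList F.toMachine.tm [decide (P a)]) := by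
    have hFa := (hF a).2
    have hsize : size τ a = 2 * (e a).length + 1 := (congrArg _ (he a)).trans (size_letters _)
    rw [hsize, he] at hFa
    rw [show decide (P a) = f a by simp [← hP a]]
    exact (evalsWithin_toMachine hFa).mono (by simp)
  refine ⟨⟨F.toMachine, 2 * Polynomial.X + 4 + p.comp (2 * Polynomial.X + 1), fun a => ?_⟩⟩
  have hmap : (e a).map F.toMachine.inputAlphabet.invFun = e a := List.map_id _
  rw [hmap]
  exact (heval a).some

end Machine

/-! ## Parsing -/

namespace Tok

variable {α : Type}

/-- The letter that ends words, names and lists, and is a term by itself. -/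
def isClose : Tok α → Bool
  | .close => true
  | _ => false

/-- The letter in front of every element of a list. -/
def isItem : Tok α → Bool
  | .item => true
  | _ => false

/-- The letters of the data values. -/
def isLetter : Tok α → Bool
  | .letter _ => true
  | _ => false

/-- The binary operation symbols of patterns and filters in prefix notation. -/
def isBinary : Tok α → Bool
  | .comp => true
  | .plus => true
  | .conj => true
  | _ => false

end Tok

/-- Strings over the input alphabet. -/
abbrev Str (α : Type) : Type := List (Tok α)

section Parsers

variable {α B C D : Type}

/-- Reading the string `u` at the beginning of the input, `f` returns `b` and the rest of the
input. -/
def Reads (f : Str α → B × Str α) (u : Str α) (b : B) : Prop := ∀ s, f (u ++ s) = (b, s)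

/-! ### Terms in prefix notation -/

/-- One step of reading a term. In the state, the length of the first component is the number of
terms that are still to be read; the other two components are the letters of the first term and the
remaining letters, both in reverse. -/
def readTermStep (y : Tok α × Str α × Str α × Str α) : Str α × Str α × Str α :=
  match y.2.1 with
  | [] => ([], y.2.2.1, y.1 :: y.2.2.2)
  | u :: c => (if y.1.isClose then c else if y.1.isBinary then u :: u :: c else u :: c,
      y.1 :: y.2.2.1, y.2.2.2)

theorem readTermStep_nil (e : Tok α) (l r : Str α) :
    readTermStep (e, [], l, r) = ([], l, e :: r) := rfl

theorem readTermStep_cons (e u : Tok α) (c l r : Str α) :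
    readTermStep (e, u :: c, l, r) =
      (if e.isClose then c else if e.isBinary then u :: u :: c else u :: c, e :: l, r) := rfl

/-- Read all letters of the input into the state of `readTermStep`. -/
def foldTerm (s : Str α) (x : Str α × Str α × Str α) : Str α × Str α × Str α :=
  s.foldl (fun x e => readTermStep (e, x)) x

/-- Split the input after its first term. -/
def readTerm (s : Str α) : Str α × Str α :=
  let r := foldTerm s ([Tok.close], [], [])
  (r.2.1.reverse, r.2.2.reverse)

/-- Strings that are a single term: reading them decreases the number of terms to be read by one. -/
def IsTerm (s : Str α) : Prop := ∀ u c l r, foldTerm s (u :: c, l, r) = (c, s.reverse ++ l, r)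

theorem foldTerm_cons (e : Tok α) (s : Str α) (x : Str α × Str α × Str α) :
    foldTerm (e :: s) x = foldTerm s (readTermStep (e, x)) := rfl

theorem foldTerm_append (s s' : Str α) (x : Str α × Str α × Str α) :
    foldTerm (s ++ s') x = foldTerm s' (foldTerm s x) := List.foldl_append

theorem foldTerm_nil_left (s l r : Str α) : foldTerm s ([], l, r) = ([], l, s.reverse ++ r) := by
  induction s generalizing r with
  | nil => rfl
  | cons e s ih => rw [foldTerm_cons, readTermStep_nil, ih, List.reverse_cons, List.append_assoc,
      List.singleton_append]

theorem IsTerm.reads {s : Str α} (h : IsTerm s) : Reads readTerm s s := fun r => by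
  simp [readTerm, foldTerm_append, h _ _ _ _, foldTerm_nil_left]

theorem isTerm_close : IsTerm [(Tok.close : Tok α)] := fun _ _ _ _ => rfl

theorem IsTerm.unary {s : Str α} (h : IsTerm s) {e : Tok α} (hclose : e.isClose = false)
    (hbinary : e.isBinary = false) : IsTerm (e :: s) := fun u c l r => by
  simp [foldTerm_cons, readTermStep_cons, hclose, hbinary, h _ _ _ _]

theorem IsTerm.binary {s s' : Str α} (h : IsTerm s) (h' : IsTerm s') {e : Tok α}
    (hclose : e.isClose = false) (hbinary : e.isBinary = true) : IsTerm (e :: (s ++ s')) :=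
  fun u c l r => by
    simp [foldTerm_cons, foldTerm_append, readTermStep_cons, hclose, hbinary, h _ _ _ _,
      h' _ _ _ _]

theorem isTerm_encodeWord (d : List α) : IsTerm (encodeWord d) := by
  induction d with
  | nil => exact isTerm_close
  | cons a d ih => exact ih.unary (e := .letter a) rfl rfl

theorem isTerm_encodeName (q : List Bool) : IsTerm (encodeName q : Str α) := by
  induction q with
  | nil => exact isTerm_close
  | cons b q ih => exact ih.unary (e := .bit b) rfl rfl

theorem Pattern.isTerm_encode (π : Pattern α) : IsTerm π.encode := by
  induction π with
  | word d => exact (isTerm_encodeWord d).unary rfl rfl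
  | comp _ _ h h' | plus _ _ h h' => exact h.binary h' rfl rfl
  | star _ h => exact h.unary rfl rfl

theorem EdgeFilter.isTerm_encode {Pat : Set (Pattern α)} (φ : EdgeFilter Pat) :
    IsTerm φ.encode := by
  induction φ with
  | pat π => exact (Pattern.isTerm_encode π.1).unary rfl rfl
  | prop q => exact (isTerm_encodeName q).unary rfl rfl
  | conj _ _ h h' => exact h.binary h' rfl rfl
  | neg _ h => exact h.unary rfl rfl

theorem length_foldTerm (s : Str α) (x : Str α × Str α × Str α) :
    (foldTerm s x).2.1.length + (foldTerm s x).2.2.length =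
      x.2.1.length + x.2.2.length + s.length := by
  induction s generalizing x with
  | nil => rfl
  | cons e s ih =>
    obtain ⟨_ | ⟨u, c⟩, l, r⟩ := x <;>
      simp only [foldTerm_cons, ih, readTermStep_nil, readTermStep_cons, List.length_cons] <;> omega

theorem size_readTerm (s : Str α) : size (Tok α) (readTerm s) = size (Tok α) s + 2 := by
  have hlength : (readTerm s).1.length + (readTerm s).2.length = s.length := by
    simpa [readTerm] using length_foldTerm s ([Tok.close], [], [])
  simp only [size_prod, size_letters]
  omega

theorem size_readTermStep_le (e : Tok α) (x : Str α × Str α × Str α) :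
    size (Tok α) (readTermStep (e, x)) ≤ size (Tok α) x + 4 := by
  obtain ⟨_ | ⟨u, c⟩, l, r⟩ := x
  · simp only [readTermStep_nil, size_prod, size_nil, size_cons, size_atom]
    omega
  · simp only [readTermStep_cons]
    split_ifs <;> simp only [size_prod, size_cons, size_atom] <;> omega

/-! ### Pairs and lists -/

/-- Read two consecutive objects. -/
def readBoth (f : Str α → B × Str α) (g : Str α → C × Str α) (s : Str α) : (B × C) × Str α :=
  (((f s).1, (g (f s).2).1), (g (f s).2).2)

theorem Reads.both {f : Str α → B × Str α} {g : Str α → C × Str α} {u v : Str α} {b : B} {c : C}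
    (hf : Reads f u b) (hg : Reads g v c) : Reads (readBoth f g) (u ++ v) (b, c) := fun s => by
  rw [List.append_assoc, readBoth, hf, hg]

theorem size_readBoth_le [ToSexp (Tok α) B] [ToSexp (Tok α) C] {f : Str α → B × Str α}
    {g : Str α → C × Str α} {i j : ℕ} (hf : ∀ s, size (Tok α) (f s) ≤ size (Tok α) s + i)
    (hg : ∀ s, size (Tok α) (g s) ≤ size (Tok α) s + j) (s : Str α) :
    size (Tok α) (readBoth f g s) ≤ size (Tok α) s + (i + j) := by
  have hfs := hf s
  have hgs := hg (f s).2
  simp only [readBoth, size_prod] at hfs hgs ⊢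
  omega

/-- Try to read one more element of a list. The letter `y.1` plays no role: the step is repeated
for every letter of the input. -/
def readListStep (f : Str α → B × Str α) (y : Tok α × List B × Str α) : List B × Str α :=
  match y.2.2 with
  | [] => y.2
  | e :: s => if e.isItem then ((f s).1 :: y.2.1, (f s).2) else y.2

theorem readListStep_close (f : Str α → B × Str α) (a : Tok α) (l : List B) (s : Str α) :
    readListStep f (a, l, .close :: s) = (l, .close :: s) := rfl

theorem readListStep_item (f : Str α → B × Str α) (a : Tok α) (l : List B) (s : Str α) :
    readListStep f (a, l, .item :: s) = ((f s).1 :: l, (f s).2) := rfl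

/-- Read a list; its elements are first collected in reverse. -/
def readList (f : Str α → B × Str α) (s : Str α) : List B × Str α :=
  let r := s.foldl (fun x e => readListStep f (e, x)) ([], s)
  (r.1.reverse, r.2.tail)

theorem foldl_readListStep_close (f : Str α → B × Str α) (w : Str α) (l : List B) (s : Str α) :
    w.foldl (fun x e => readListStep f (e, x)) (l, .close :: s) = (l, .close :: s) := by
  induction w with
  | nil => rfl
  | cons a w ih => rwa [List.foldl_cons, readListStep_close]

theorem foldl_readListStep_encodeList {f : Str α → B × Str α} {e : D → Str α} {g : D → B}
    (h : ∀ x, Reads f (e x) (g x)) {w : Str α} {l : List D} (hl : l.length ≤ w.length)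
    (l' : List B) (s : Str α) :
    w.foldl (fun x e => readListStep f (e, x)) (l', encodeList e l ++ s) =
      ((l.map g).reverse ++ l', .close :: s) := by
  induction l generalizing w l' with
  | nil => exact foldl_readListStep_close f w l' s
  | cons x l ih =>
    cases w with
    | nil => simp at hl
    | cons a w =>
      rw [List.foldl_cons, encodeList, List.cons_append, List.append_assoc, readListStep_item, h,
        ih (by simpa using hl)]
      simp

theorem length_le_length_encodeList (e : D → Str α) (l : List D) :
    l.length ≤ (encodeList e l).length := by
  induction l with
  | nil => simp
  | cons x l ih =>
    simp only [encodeList, List.length_cons, List.length_append]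
    omega

theorem Reads.list {f : Str α → B × Str α} {e : D → Str α} {g : D → B}
    (h : ∀ x, Reads f (e x) (g x)) (l : List D) :
    Reads (readList f) (encodeList e l) (l.map g) := fun s => by
  have hl : l.length ≤ (encodeList e l ++ s).length :=
    (length_le_length_encodeList e l).trans (by simp)
  simp [readList, foldl_readListStep_encodeList h hl]

theorem size_readListStep_le [ToSexp (Tok α) B] {f : Str α → B × Str α} {i : ℕ}
    (hf : ∀ s, size (Tok α) (f s) ≤ size (Tok α) s + i) (e : Tok α) (x : List B × Str α) :
    size (Tok α) (readListStep f (e, x)) ≤ size (Tok α) x + i := by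
  obtain ⟨l, _ | ⟨a, s⟩⟩ := x
  · exact Nat.le_add_right _ _
  · have hfs := hf s
    simp only [readListStep]
    split_ifs
    · simp only [size_prod, size_cons, size_atom] at hfs ⊢
      omega
    · exact Nat.le_add_right _ _

end Parsers

namespace PolyTime

variable {α B C : Type} [ToSexp (Tok α) B] [ToSexp (Tok α) C] {O : TM2ComputableAux (Tok α) Bool}

theorem readTermStep : PolyTime O (readTermStep (α := α)) := by
  let T : Type := Tok α × Str α × Str α × Str α
  have hletter : PolyTime O fun z : (Tok α × Str α) × T => z.2.1 := fst.comp snd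
  have hcounter : PolyTime O fun z : (Tok α × Str α) × T => z.1.2 := snd.comp fst
  have hsame : PolyTime O fun z : (Tok α × Str α) × T => z.1.1 :: z.1.2 :=
    (fst.comp fst).cons hcounter
  refine (listCase (l := fun y : T => y.2.1)
    (f := fun y => (([], y.2.2.1, y.1 :: y.2.2.2) : Str α × Str α × Str α))
    (g := fun z => (if z.2.1.isClose then z.1.2 else if z.2.1.isBinary then
      z.1.1 :: z.1.1 :: z.1.2 else z.1.1 :: z.1.2, z.2.1 :: z.2.2.2.1, z.2.2.2.2))
    (fst.comp snd) ((const _).pair ((fst.comp (snd.comp snd)).pair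
      (fst.cons (snd.comp (snd.comp snd)))))
    ((((letter Tok.isClose).comp hletter).ite hcounter (((letter Tok.isBinary).comp hletter).ite
      ((fst.comp fst).cons hsame) hsame)).pair
        ((hletter.cons (fst.comp (snd.comp (snd.comp snd)))).pair
          (snd.comp (snd.comp (snd.comp snd)))))).congr ?_
  rintro ⟨e, _ | ⟨u, c⟩, x⟩ <;> rfl

theorem readTerm : PolyTime O (readTerm (α := α)) := by
  have hfold := (foldl_of_size_le readTermStep 4 fun e x =>
    (size_readTermStep_le e x).trans (by simp)).comp
    (id.pair (const ([Tok.close], [], [])) : PolyTime O fun s : Str α =>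
      (s, (([Tok.close], [], []) : Str α × Str α × Str α)))
  exact (reverse.comp (fst.comp (snd.comp hfold))).pair (reverse.comp (snd.comp (snd.comp hfold)))

theorem readBoth {f : Str α → B × Str α} {g : Str α → C × Str α} (hf : PolyTime O f)
    (hg : PolyTime O g) : PolyTime O (readBoth f g) :=
  ((fst.comp hf).pair (fst.comp (hg.comp (snd.comp hf)))).pair (snd.comp (hg.comp (snd.comp hf)))

theorem readListStep {f : Str α → B × Str α} (hf : PolyTime O f) :
    PolyTime O (readListStep f) := by
  let T : Type := Tok α × List B × Str α
  have hread : PolyTime O fun z : (Tok α × Str α) × T => f z.1.2 := hf.comp (snd.comp fst)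
  refine (listCase (l := fun y : T => y.2.2) (f := fun y => y.2)
    (g := fun z => if z.1.1.isItem then ((f z.1.2).1 :: z.2.2.1, (f z.1.2).2) else z.2.2)
    (snd.comp snd) snd (((letter Tok.isItem).comp (fst.comp fst)).ite
      (((fst.comp hread).cons (fst.comp (snd.comp snd))).pair (snd.comp hread))
      (snd.comp snd))).congr ?_
  rintro ⟨e, l, _ | ⟨a, s⟩⟩ <;> rfl

theorem readList {f : Str α → B × Str α} (hf : PolyTime O f) (i : ℕ)
    (hi : ∀ s, size (Tok α) (f s) ≤ size (Tok α) s + i) : PolyTime O (readList f) := by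
  have hfold := (foldl_of_size_le (readListStep hf) (Polynomial.C i) fun e x =>
    (size_readListStep_le hi e x).trans (by simp)).comp
    (id.pair ((const []).pair id) : PolyTime O fun s : Str α => (s, (([], s) : List B × Str α)))
  exact (reverse.comp (fst.comp hfold)).pair (tail.comp (snd.comp hfold))

end PolyTime

/-! ## The membership algorithm -/

/-- Names of states, represented by their string encoding: a copy of `List Bool`, which is itself
represented as a list. -/
def Name : Type := List Bool

instance : DecidableEq Name := inferInstanceAs (DecidableEq (List Bool))

/-- Data values, represented by their string encoding. -/
def Word (α : Type) : Type := List α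

/-- The empty data value. -/
def Word.nil {α : Type} : Word α := ([] : List α)

/-- Data values together with at most one state, represented by their string encoding. -/
def QItem (α : Type) : Type := List α × Option Name

/-- The part of the encoding of an instance of singleton-membership that describes the item. -/
def QItem.encode {α : Type} (x : QItem α) : Str α :=
  encodeWord x.1 ++ encodeList encodeName (Option.toList x.2)

/-- The item described by `x`. -/
def QItem.toItem {α : Type} (x : QItem α) : Item α := (x.1, {q | x.2 = some q})

/-- Instances of singleton-membership, represented by their string encoding. -/
def Query {α : Type} (Pat : Set (Pattern α)) : Type := SingletonInstance Pat

section Algorithm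

variable {α : Type} {Pat : Set (Pattern α)}

instance : ToSexp (Tok α) Name := ⟨fun q => ToSexp.toSexp (encodeName q : Str α)⟩

instance : ToSexp (Tok α) (Word α) := ⟨fun d => ToSexp.toSexp (encodeWord d : Str α)⟩

instance : ToSexp (Tok α) (QItem α) := ⟨fun x => ToSexp.toSexp x.encode⟩

instance : ToSexp (Tok α) (EdgeFilter Pat) := ⟨fun φ => ToSexp.toSexp φ.encode⟩

instance : ToSexp (Tok α) (Query Pat) := ⟨fun x => ToSexp.toSexp (SingletonInstance.encode x)⟩

open Classical in
/-- Singleton-membership as a Boolean function. -/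
noncomputable def Query.holds (x : Query Pat) : Bool := decide (SingletonInstance.Holds x)

/-- Rules `p → p'` of horizontal automata with a filter, as a triple `(p, φ, p')`. -/
abbrev Rule (Pat : Set (Pattern α)) : Type := Name × EdgeFilter Pat × Name

/-- Vertical rules `(p₀, p') → q`, as a pair `(p', q)`. -/
abbrev VRule : Type := Name × Name

/-- The parts of an automaton that are used by the algorithm: the horizontal rules, the initial
horizontal state, the final states and the vertical rules. -/
abbrev Params (Pat : Set (Pattern α)) : Type := List (Rule Pat) × Name × List Name × List VRule

/-- Combine a filter and an item into an instance of singleton-membership. -/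
def mkQuery (y : EdgeFilter Pat × QItem α) : Query Pat := y

/-- Whether a rule is applicable to an item in a horizontal state. -/
noncomputable def applies (y : Rule Pat × QItem α × Name) : Bool :=
  decide (y.1.1 = y.2.2) && (mkQuery (y.1.2.1, y.2.1)).holds

/-- Apply the first applicable rule to an item, or keep the item if there is none. The state
consists of the horizontal state and the items that have been kept. -/
noncomputable def consumeStep (y : QItem α × List (Rule Pat) × Name × List (QItem α)) :
    Name × List (QItem α) :=
  match y.2.1.find? fun r => applies (r, y.1, y.2.2.1) with
  | none => (y.2.2.1, y.1 :: y.2.2.2)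
  | some r => (r.2.2, y.2.2.2)

/-- Perform `consumeStep` for all items of a list. -/
noncomputable def consume (rs : List (Rule Pat)) (l : List (QItem α))
    (s : Name × List (QItem α)) : Name × List (QItem α) :=
  l.foldl (fun s x => consumeStep (x, rs, s)) s

/-- Try to consume every item once. -/
noncomputable def pass (rs : List (Rule Pat)) (s : Name × List (QItem α)) : Name × List (QItem α) :=
  consume rs s.2 (s.1, [])

/-- Consume items greedily, as long as possible: every pass consumes an item or is stuck, so there
are at most as many useful passes as items. -/
noncomputable def run (rs : List (Rule Pat)) (s : Name × List (QItem α)) : Name × List (QItem α) :=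
  (pass rs)^[s.2.length] s

/-- The right-hand side of the first vertical rule for a horizontal state. -/
def target (y : List VRule × Name) : Option Name :=
  (y.1.find? fun v => decide (v.1 = y.2)).map Prod.snd

/-- The state to which a list of items is evaluated. -/
noncomputable def value (y : Params Pat × List (QItem α)) : Option Name :=
  let s := run y.1.1 (y.1.2.1, y.2)
  if s.2.isEmpty then target (y.1.2.2.2, s.1) else none

/-- Put a letter in front of a data value. -/
def letterCons (y : Tok α × Word α) : Word α :=
  match y.1 with
  | .letter a => List.cons a y.2
  | _ => y.2

/-- Combine a data value and an optional state into an item. -/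
def mkItem (y : Word α × Option Name) : QItem α := y

/-- One step of the evaluation of the encoding of a tree, from right to left. The state consists of
the data value that is being read and a stack of lists of items, one for every tree that has been
read. The letter `close` at the end of a data value looks like an empty tree; the list that it
pushes is removed at the letter `item` in front of the data value. -/
noncomputable def treeStep (y : Tok α × Params Pat × Word α × List (List (QItem α))) :
    Word α × List (List (QItem α)) :=
  if y.1.isClose then (Word.nil, [] :: y.2.2.2)
  else if y.1.isLetter then (letterCons (y.1, y.2.2.1), y.2.2.2)
  else match y.2.2.2 with
    | _ :: M :: N :: l => (Word.nil, (mkItem (y.2.2.1, value (y.2.1, M)) :: N) :: l)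
    | _ => y.2.2

/-- Evaluate the encoding of a tree. -/
noncomputable def readTree (y : Params Pat × Str α) : Word α × List (List (QItem α)) :=
  y.2.foldr (fun e s => treeStep (e, y.1, s)) (Word.nil, [])

/-- Membership in a list of names. -/
def memName (y : List Name × Name) : Bool := y.1.any fun q => decide (q = y.2)

/-- Whether an automaton accepts an encoded tree. -/
noncomputable def accepts (y : Params Pat × Str α) : Bool :=
  match (readTree y).2 with
  | [] => false
  | M :: _ => match value (y.1, M) with
    | none => false
    | some q => memName (y.1.2.2.1, q)

/-! ### Bounds on the sizes of the values -/

theorem size_consumeStep_le (x : QItem α) (rs : List (Rule Pat)) (s : Name × List (QItem α)) :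
    size (Tok α) (consumeStep (x, rs, s)).1 ≤ max (size (Tok α) s.1) (size (Tok α) rs) ∧
      size (Tok α) (consumeStep (x, rs, s)).2 ≤ size (Tok α) s.2 + size (Tok α) x + 1 := by
  simp only [consumeStep]
  split
  · exact ⟨le_max_left _ _, by simp only [size_cons]; omega⟩
  · next r hr =>
    have hmem : size (Tok α) r < size (Tok α) rs := size_lt_of_mem (List.mem_of_find?_eq_some hr)
    simp only [size_prod] at hmem ⊢
    exact ⟨le_max_of_le_right (by omega), by omega⟩

theorem size_consume_le (rs : List (Rule Pat)) (l : List (QItem α)) (s : Name × List (QItem α)) :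
    size (Tok α) (consume rs l s).1 ≤ max (size (Tok α) s.1) (size (Tok α) rs) ∧
      size (Tok α) (consume rs l s).2 + 1 ≤ size (Tok α) s.2 + size (Tok α) l := by
  induction l generalizing s with
  | nil => exact ⟨le_max_left _ _, le_rfl⟩
  | cons x l ih =>
    have hrest := ih (consumeStep (x, rs, s))
    have hstep := size_consumeStep_le x rs s
    simp only [consume, List.foldl_cons, size_cons, le_max_iff] at hrest hstep ⊢
    omega

theorem size_pass_le (rs : List (Rule Pat)) (s : Name × List (QItem α)) :
    size (Tok α) (pass rs s) ≤ size (Tok α) s + size (Tok α) rs := by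
  obtain ⟨hstate, hitems⟩ := size_consume_le rs s.2 (s.1, [])
  simp only [pass, size_prod, size_nil, le_max_iff] at hstate hitems ⊢
  omega

theorem size_target_le (vs : List VRule) (p : Name) :
    size (Tok α) (target (vs, p)) ≤ size (Tok α) vs + 2 := by
  rcases hv : vs.find? fun v => decide (v.1 = p) with _ | v
  · simp [target, hv]
  · have hmem : size (Tok α) v < size (Tok α) vs := size_lt_of_mem (List.mem_of_find?_eq_some hv)
    simp only [target, hv, Option.map_some, size_some, size_prod] at hmem ⊢
    omega

theorem size_value_le (g : Params Pat) (l : List (QItem α)) :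
    size (Tok α) (value (g, l)) ≤ size (Tok α) g + 2 := by
  simp only [value]
  split_ifs
  · have htarget := size_target_le (α := α) g.2.2.2 (run g.1 (g.2.1, l)).1
    simp only [size_prod]
    omega
  · simp

theorem size_name (q : Name) : size (Tok α) q = size (Tok α) (encodeName q : Str α) := rfl

theorem length_encodeWord (d : List α) : (encodeWord d).length = d.length + 1 := by
  rw [encodeWord, List.length_append, List.length_map, List.length_singleton]

theorem size_word (d : Word α) : size (Tok α) d = 2 * (encodeWord d).length + 1 :=
  size_letters (encodeWord d)

theorem size_mkItem_le (d : Word α) (q : Option Name) :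
    size (Tok α) (mkItem (d, q)) ≤ size (Tok α) d + size (Tok α) q + 6 := by
  have hitem : size (Tok α) (mkItem (d, q)) =
    size (Tok α) (encodeWord d ++ encodeList encodeName q.toList : Str α) := rfl
  cases q <;>
    simp only [hitem, size_word, size_name, size_some, size_none, size_letters, Option.toList,
      encodeList, List.length_append, List.length_cons, List.length_nil] <;> omega

theorem size_letterCons_le (e : Tok α) (d : Word α) :
    size (Tok α) (letterCons (e, d)) ≤ size (Tok α) d + 2 := by
  cases e with
  | letter a =>
    have hlength : (encodeWord (letterCons (.letter a, d))).length = (encodeWord d).length + 1 :=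
      rfl
    rw [size_word, size_word, hlength]
    omega
  | _ => exact Nat.le_add_right _ _

theorem size_treeStep_le (e : Tok α) (g : Params Pat) (s : Word α × List (List (QItem α))) :
    size (Tok α) (treeStep (e, g, s)) ≤ size (Tok α) s + (size (Tok α) g + 20) := by
  obtain ⟨d, l⟩ := s
  have hnil : size (Tok α) (Word.nil : Word α) = 3 := rfl
  have hd := size_word d
  have hlength := length_encodeWord d
  have hletter := size_letterCons_le e d
  simp only [treeStep]
  split_ifs
  · simp only [size_prod, size_cons, size_nil, hnil]
    omega
  · simp only [size_prod]
    omega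
  · rcases l with _ | ⟨_, _ | ⟨M, _ | ⟨N, l⟩⟩⟩
    · exact Nat.le_add_right _ _
    · exact Nat.le_add_right _ _
    · exact Nat.le_add_right _ _
    · have hvalue := size_value_le g M
      have hitem := size_mkItem_le d (value (g, M))
      simp only [size_prod, size_cons, hnil] at hvalue ⊢
      omega

end Algorithm

namespace PolyTime

/-! ### Time bounds -/

variable {α : Type} {Pat : Set (Pattern α)} {O : TM2ComputableAux (Tok α) Bool}

theorem encodeName_injective : Function.Injective (encodeName : Name → Str α) := fun _ _ h =>
  (List.map_injective_iff.2 fun a b hab => by cases hab; rfl) (List.append_cancel_right h)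

theorem nameEq : PolyTime O fun x : Name × Name => decide (x.1 = x.2) := by
  classical
  refine (eq (τ := Tok α) (O := O)).of_toSexp_eq
    (fun x : Name × Name => ((encodeName x.1 : Str α), (encodeName x.2 : Str α)))
    (fun _ => rfl) fun x => congrArg ToSexp.toSexp ?_
  rw [decide_eq_decide]
  exact encodeName_injective.eq_iff.symm

theorem mkQuery : PolyTime O (mkQuery (Pat := Pat)) :=
  (fst.append snd : PolyTime O fun y : Str α × Str α => y.1 ++ y.2).of_toSexp_eq
    (fun x : EdgeFilter Pat × QItem α => ((x.1.encode : Str α), x.2.encode)) (fun _ => rfl)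
    fun x => congrArg (ToSexp.toSexp (τ := Tok α))
      (List.append_assoc x.1.encode (encodeWord x.2.1) _)

theorem mkItem : PolyTime O (mkItem (α := α)) := by
  have hname : PolyTime O fun q : Name => (encodeName q : Str α) := of_toSexp_eq_self fun _ => rfl
  have hoption : PolyTime O fun y : Str α × Option Name => match y.2 with
      | none => [Tok.close]
      | Option.some q => Tok.item :: ((encodeName q : Str α) ++ [Tok.close]) :=
    (optionCase (f := fun _ => [Tok.close])
      (g := fun z : Name × Str α × Option Name => Tok.item :: (encodeName z.1 ++ [Tok.close]))
      snd (const _) (((const Tok.item).cons (hname.append (const _))).comp fst)).congr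
      fun ⟨_, q⟩ => by cases q <;> rfl
  refine (fst.append hoption).of_toSexp_eq
    (fun y : Word α × Option Name => ((encodeWord y.1 : Str α), y.2)) (fun _ => rfl) ?_
  rintro ⟨d, _ | q⟩ <;> rfl

theorem letterCons : PolyTime O (letterCons (α := α)) := by
  refine (((letter Tok.isLetter).comp fst).ite (fst.cons snd) snd : PolyTime O
    fun y : Tok α × Str α => if y.1.isLetter then y.1 :: y.2 else y.2).of_toSexp_eq
      (fun y => (y.1, (encodeWord y.2 : Str α))) (fun _ => rfl) ?_
  rintro ⟨e, d⟩
  cases e <;> rfl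

theorem target : PolyTime O target := by
  have hfind : PolyTime O fun y : List VRule × Name => y.1.find? fun v => decide (v.1 = y.2) :=
    find? (c := fun z : VRule × Name => decide (z.1.1 = z.2))
      (nameEq.comp ((fst.comp fst).pair snd))
  refine (optionCase (f := fun _ => none)
    (g := fun z : VRule × List VRule × Name => Option.some z.1.2)
    hfind (const none) (snd.comp fst).some).congr fun y => ?_
  unfold UTA.target
  cases y.1.find? fun v => decide (v.1 = y.2) <;> rfl

theorem memName : PolyTime O memName := any nameEq

theorem applies (hO : PolyTime O (Query.holds (Pat := Pat))) :
    PolyTime O (applies (Pat := Pat)) := by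
  have hquery : PolyTime O fun y : Rule Pat × QItem α × Name =>
      UTA.mkQuery (y.1.2.1, y.2.1) :=
    mkQuery.comp ((fst.comp (snd.comp fst)).pair (fst.comp snd))
  exact (nameEq.comp ((fst.comp fst).pair (snd.comp snd))).and (hO.comp hquery)

theorem consumeStep (hO : PolyTime O (Query.holds (Pat := Pat))) :
    PolyTime O (consumeStep (Pat := Pat)) := by
  let T : Type := QItem α × List (Rule Pat) × Name × List (QItem α)
  have hstate : PolyTime O fun y : T => y.2.2.1 := fst.comp (snd.comp snd)
  have hkept : PolyTime O fun y : T => y.2.2.2 := snd.comp (snd.comp snd)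
  have hfind : PolyTime O fun y : T => y.2.1.find? fun r => UTA.applies (r, y.1, y.2.2.1) :=
    (find? (applies hO)).comp ((fst.comp snd).pair (fst.pair hstate))
  refine (optionCase (g := fun z : Rule Pat × T => (z.1.2.2, z.2.2.2.2)) hfind
    (hstate.pair (fst.cons hkept)) ((snd.comp (snd.comp fst)).pair (hkept.comp snd))).congr
    fun y => ?_
  unfold UTA.consumeStep
  cases y.2.1.find? fun r => UTA.applies (r, y.1, y.2.2.1) <;> rfl

theorem pass (hO : PolyTime O (Query.holds (Pat := Pat))) :
    PolyTime O fun y : List (Rule Pat) × Name × List (QItem α) => pass y.1 y.2 := by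
  have hconsume := foldl_param (consumeStep hO) (Polynomial.X + 1) fun x rs s => by
    obtain ⟨hstate, hitems⟩ := size_consumeStep_le x rs s
    simp only [size_prod, le_max_iff, Polynomial.eval_add, Polynomial.eval_X,
      Polynomial.eval_one] at hstate hitems ⊢
    omega
  exact (hconsume.comp ((snd.comp snd).pair (fst.pair ((fst.comp snd).pair (const []))))).congr
    fun _ => rfl

theorem run (hO : PolyTime O (Query.holds (Pat := Pat))) :
    PolyTime O fun y : List (Rule Pat) × Name × List (QItem α) => run y.1 y.2 := by
  have hpasses := foldl_param (f := fun y : QItem α × List (Rule Pat) × Name × List (QItem α) =>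
    UTA.pass y.2.1 y.2.2) ((pass hO).comp snd) Polynomial.X fun x rs s => by
      have hpass := size_pass_le rs s
      rw [Polynomial.eval_X]
      dsimp only
      omega
  exact (hpasses.comp ((snd.comp snd).pair id)).congr
    fun y => List.foldl_const (UTA.pass y.1) y.2 y.2.2

theorem value (hO : PolyTime O (Query.holds (Pat := Pat))) : PolyTime O (value (Pat := Pat)) := by
  have hrun := (run hO).comp ((fst.comp fst).pair ((fst.comp (snd.comp fst)).pair snd) :
    PolyTime O fun y : Params Pat × List (QItem α) => (y.1.1, y.1.2.1, y.2))
  exact (isEmpty.comp (snd.comp hrun)).ite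
    (target.comp ((snd.comp (snd.comp (snd.comp fst))).pair (fst.comp hrun))) (const none)

theorem treeStep (hO : PolyTime O (Query.holds (Pat := Pat))) :
    PolyTime O (treeStep (Pat := Pat)) := by
  let T : Type := Tok α × Params Pat × Word α × List (List (QItem α))
  let L : Type := List (QItem α) × List (List (QItem α))
  have hword : PolyTime O fun y : T => y.2.2.1 := fst.comp (snd.comp snd)
  have hstack : PolyTime O fun y : T => y.2.2.2 := snd.comp (snd.comp snd)
  have hkeep : PolyTime O fun y : T => y.2.2 := snd.comp snd
  have hitem : PolyTime O fun z : L × L × L × T =>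
      UTA.mkItem (z.2.2.2.2.2.1, UTA.value (z.2.2.2.2.1, z.2.1.1)) :=
    mkItem.comp ((hword.comp (snd.comp (snd.comp snd))).pair ((value hO).comp
      (((fst.comp snd).comp (snd.comp (snd.comp snd))).pair (fst.comp (fst.comp snd)))))
  have hedge := listCase hstack hkeep (listCase (l := fun z : L × T => z.1.2) (snd.comp fst)
    (hkeep.comp snd) (listCase (l := fun z : L × L × T => z.1.2) (snd.comp fst)
      (hkeep.comp (snd.comp snd)) ((const (Word.nil : Word α)).pair
        ((hitem.cons (fst.comp fst)).cons (snd.comp fst)))))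
  refine (((letter Tok.isClose).comp fst).ite ((const Word.nil).pair ((const []).cons hstack))
    (((letter Tok.isLetter).comp fst).ite ((letterCons.comp (fst.pair hword)).pair hstack)
      hedge)).congr ?_
  rintro ⟨e, g, d, _ | ⟨_, _ | ⟨_, _ | _⟩⟩⟩ <;> rfl

theorem readTree (hO : PolyTime O (Query.holds (Pat := Pat))) :
    PolyTime O (readTree (Pat := Pat)) :=
  ((foldl_param (treeStep hO) (Polynomial.X + 20) fun e g s =>
    (size_treeStep_le e g s).trans (by simp)).comp
      ((reverse.comp snd).pair (fst.pair (const (Word.nil, []))))).congr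
    fun _ => List.foldl_reverse

theorem accepts (hO : PolyTime O (Query.holds (Pat := Pat))) :
    PolyTime O (accepts (Pat := Pat)) := by
  let T : Type := Params Pat × Str α
  let L : Type := List (QItem α) × List (List (QItem α))
  have hroot := optionCase (o := fun z : L × T => UTA.value (z.2.1, z.1.1))
    ((value hO).comp ((fst.comp snd).pair (fst.comp fst))) (const false)
    (memName.comp (((fst.comp (snd.comp (snd.comp fst))).comp (snd.comp snd)).pair fst))
  refine (listCase (l := fun y : T => (UTA.readTree y).2) (snd.comp (readTree hO))
    (const false) hroot).congr fun y => ?_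
  unfold UTA.accepts
  rcases (UTA.readTree y).2 with _ | ⟨M, l⟩
  · rfl
  · dsimp only
    cases UTA.value (y.1, M) <;> rfl

end PolyTime

section Correctness

variable {α : Type} {Pat : Set (Pattern α)}

/-! ## Reading the input -/

/-- Inputs of the membership problem, represented by their string encoding. -/
def Source (Pat : Set (Pattern α)) : Type := MembershipInstance Pat

instance : ToSexp (Tok α) (Source Pat) := ⟨fun x => ToSexp.toSexp (MembershipInstance.encode x)⟩

/-- The rules of a horizontal automaton, with its states represented by their encoding. -/
def HAut.ruleList (H : HAut Pat) : List (Rule Pat) := H.rules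

/-- The part of an automaton that is used by the algorithm. -/
def AUTC.params (C : AUTC Pat) : Params Pat :=
  (C.H.ruleList, C.p₀.1, C.A.final, C.A.rules.map fun r => (r.1.1.2.1, r.2))

/-- The encoding of a horizontal rule, split into its parts. -/
def Rule.encode (r : Rule Pat) : Str α × Str α × Str α :=
  (encodeName r.1, r.2.1.encode, encodeName r.2.2)

/-- The encoding of a vertical rule, split into its parts. -/
def VRule.encode (r : VRule) : Str α × Str α := (encodeName r.1, encodeName r.2)

/-- Read the encoding of a horizontal rule. -/
def readRule : Str α → (Str α × Str α × Str α) × Str α :=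
  readBoth readTerm (readBoth readTerm readTerm)

/-- Read the encoding of a vertical rule. -/
def readVRule : Str α → (Str α × Str α) × Str α := readBoth readTerm readTerm

/-- Read the encoding of an automaton. -/
def readAutomaton : Str α → (((((List (Str α) × List (Str α × Str α × Str α)) × Str α) ×
    List (Str α)) × List (Str α)) × List (Str α × Str α)) × Str α :=
  readBoth (readBoth (readBoth (readBoth (readBoth (readList readTerm) (readList readRule))
    readTerm) (readList readTerm)) (readList readTerm)) (readList readVRule)

theorem reads_encodeName (q : Name) : Reads readTerm (encodeName q : Str α) (encodeName q) :=
  (isTerm_encodeName q).reads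

theorem reads_readRule (r : Rule Pat) :
    Reads readRule (encodeName r.1 ++ r.2.1.encode ++ encodeName r.2.2) r.encode := by
  rw [List.append_assoc]
  exact (reads_encodeName r.1).both (r.2.1.isTerm_encode.reads.both (reads_encodeName r.2.2))

theorem reads_readAutomaton (C : AUTC Pat) : Reads readAutomaton C.encode
    (((((C.H.states.map encodeName, C.params.1.map Rule.encode), encodeName C.params.2.1),
      C.A.states.map encodeName), C.params.2.2.1.map encodeName),
      C.params.2.2.2.map VRule.encode) := by
  have hvrules : C.params.2.2.2.map VRule.encode =
      C.A.rules.map fun r => ((encodeName r.1.1.2.1 : Str α), (encodeName r.2 : Str α)) :=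
    List.map_map
  rw [hvrules]
  exact (((((Reads.list reads_encodeName _).both (Reads.list reads_readRule _)).both
    (reads_encodeName _)).both (Reads.list reads_encodeName _)).both
    (Reads.list reads_encodeName _)).both
    (Reads.list (fun r => (reads_encodeName _).both (reads_encodeName _)) _)

variable {O : TM2ComputableAux (Tok α) Bool}

theorem PolyTime.readAutomaton : PolyTime O (readAutomaton (α := α)) := by
  have hterm : ∀ s : Str α, size (Tok α) (UTA.readTerm s) ≤ size (Tok α) s + 2 :=
    fun s => (size_readTerm s).le
  have hpair := size_readBoth_le hterm hterm
  have hnames := PolyTime.readList (O := O) readTerm 2 hterm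
  have hvrule : PolyTime O (readVRule (α := α)) := readTerm.readBoth readTerm
  have hrules := PolyTime.readList (readTerm.readBoth hvrule) _ (size_readBoth_le hterm hpair)
  exact ((((hnames.readBoth hrules).readBoth readTerm).readBoth hnames).readBoth hnames).readBoth
    (hvrule.readList _ hpair)

theorem PolyTime.parse :
    PolyTime O fun x : Source Pat => (AUTC.params x.1, (TreeTerm.encode x.2 : Str α)) := by
  have hread := PolyTime.readAutomaton (α := α) (O := O)
  have hautomaton := fst.comp hread
  have hfinal := fst.comp hautomaton
  have hinitial := fst.comp (fst.comp hfinal)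
  have hparts := ((snd.comp (fst.comp hinitial)).pair ((snd.comp hinitial).pair
    ((snd.comp hfinal).pair (snd.comp hautomaton)))).pair (snd.comp hread)
  refine hparts.of_toSexp_eq (fun x => MembershipInstance.encode x) (fun _ => rfl) ?_
  rintro ⟨C, t⟩
  have hencode : MembershipInstance.encode (C, t) = C.encode ++ t.encode := rfl
  have hrules : (ToSexp.toSexp (C.params.1.map Rule.encode) : Sexp (Tok α)) =
      ToSexp.toSexp C.params.1 := toSexp_map (f := Rule.encode) (fun _ => rfl) _
  have hnames : (ToSexp.toSexp (C.params.2.2.1.map (encodeName (α := α))) : Sexp (Tok α)) =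
      ToSexp.toSexp C.params.2.2.1 :=
    toSexp_map (A := Name) (f := encodeName (α := α)) (fun _ => rfl) _
  have hvrules : (ToSexp.toSexp (C.params.2.2.2.map (VRule.encode (α := α))) : Sexp (Tok α)) =
      ToSexp.toSexp C.params.2.2.2 := toSexp_map (f := VRule.encode (α := α)) (fun _ => rfl) _
  simp only [hencode, reads_readAutomaton C t.encode]
  exact congrArg₂ Sexp.cons (congrArg₂ Sexp.cons hrules.symm (congrArg₂ Sexp.cons rfl
    (congrArg₂ Sexp.cons hnames.symm hvrules.symm))) rfl

/-! ## Greedy runs -/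

/-- The multiset of items described by a list. -/
def items (l : List (QItem α)) : Multiset (Item α) := (l.map QItem.toItem : List (Item α))

/-- The configuration of a horizontal automaton that is represented by `s`. -/
def config (s : Name × List (QItem α)) : HState × Multiset (Item α) := (s.1, items s.2)

theorem config_congr {l l' : List (QItem α)} (h : l.Perm l') (p : Name) :
    config (p, l) = config (p, l') :=
  congrArg (Prod.mk (α := HState) p) (Multiset.coe_eq_coe.2 (h.map _))

/-- No rule can consume `x` in the horizontal state `p`. -/
def Stuck (rs : List (Rule Pat)) (p : Name) (x : QItem α) : Prop :=
  ∀ r ∈ rs, r.1 = p → ¬ r.2.1.Sat x.toItem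

/-- No rule can consume an item that is left in the configuration `s`. -/
def AllStuck (rs : List (Rule Pat)) (s : Name × List (QItem α)) : Prop :=
  ∀ x ∈ s.2, Stuck rs s.1 x

theorem applies_iff (r : Rule Pat) (x : QItem α) (p : Name) :
    applies (r, x, p) = true ↔ r.1 = p ∧ r.2.1.Sat x.toItem := by
  rw [applies, Bool.and_eq_true]
  exact and_congr decide_eq_true_iff (@decide_eq_true_iff _ (Classical.propDecidable _))

theorem consumeStep_of_stuck {rs : List (Rule Pat)} {p : Name} {x : QItem α} (h : Stuck rs p x)
    (m : List (QItem α)) : consumeStep (x, rs, p, m) = (p, x :: m) := by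
  have hfind : (rs.find? fun r => applies (r, x, p)) = none :=
    List.find?_eq_none.2 fun r hr happlies =>
      have ⟨hp, hsat⟩ := (applies_iff r x p).1 happlies
      h r hr hp hsat
  simp only [consumeStep, hfind]

theorem consumeStep_of_not_stuck {rs : List (Rule Pat)} {p : Name} {x : QItem α}
    (h : ¬ Stuck rs p x) (m : List (QItem α)) :
    ∃ r ∈ rs, r.1 = p ∧ r.2.1.Sat x.toItem ∧ consumeStep (x, rs, p, m) = (r.2.2, m) := by
  rcases hfind : rs.find? fun r => applies (r, x, p) with _ | r
  · refine absurd (fun r hr hp hsat => ?_) h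
    exact List.find?_eq_none.1 hfind r hr ((applies_iff r x p).2 ⟨hp, hsat⟩)
  · obtain ⟨hp, hsat⟩ := (applies_iff r x p).1 (List.find?_some hfind :)
    exact ⟨r, List.mem_of_find?_eq_some hfind, hp, hsat, by simp only [consumeStep, hfind]⟩

theorem consume_cons (rs : List (Rule Pat)) (x : QItem α) (l : List (QItem α))
    (s : Name × List (QItem α)) : consume rs (x :: l) s = consume rs l (consumeStep (x, rs, s)) :=
  rfl

theorem consume_of_stuck {rs : List (Rule Pat)} {p : Name} {l : List (QItem α)}
    (h : ∀ x ∈ l, Stuck rs p x) (m : List (QItem α)) :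
    consume rs l (p, m) = (p, l.reverse ++ m) := by
  induction l generalizing m with
  | nil => rfl
  | cons x l ih =>
    rw [List.forall_mem_cons] at h
    rw [consume_cons, consumeStep_of_stuck h.1, ih h.2, List.reverse_cons, List.append_assoc,
      List.singleton_append]

theorem length_consumeStep_le (rs : List (Rule Pat)) (x : QItem α) (s : Name × List (QItem α)) :
    (consumeStep (x, rs, s)).2.length ≤ s.2.length + 1 := by
  by_cases h : Stuck rs s.1 x
  · rw [consumeStep_of_stuck h, List.length_cons]
  · obtain ⟨r, -, -, -, hr⟩ := consumeStep_of_not_stuck h s.2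
    rw [hr]
    exact Nat.le_succ _

theorem length_consume_le (rs : List (Rule Pat)) (l : List (QItem α)) (s : Name × List (QItem α)) :
    (consume rs l s).2.length ≤ l.length + s.2.length := by
  induction l generalizing s with
  | nil => exact (Nat.zero_add _).ge
  | cons x l ih =>
    have hrest := ih (consumeStep (x, rs, s))
    have hstep := length_consumeStep_le rs x s
    rw [consume_cons, List.length_cons]
    omega

theorem stuck_of_length_consume {rs : List (Rule Pat)} {l : List (QItem α)} {p : Name}
    {m : List (QItem α)} (h : l.length + m.length ≤ (consume rs l (p, m)).2.length) :
    ∀ x ∈ l, Stuck rs p x := by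
  induction l generalizing m with
  | nil => exact List.forall_mem_nil _
  | cons x l ih =>
    rw [consume_cons, List.length_cons] at h
    have hx : Stuck rs p x := by
      by_contra hx
      obtain ⟨r, -, -, -, hr⟩ := consumeStep_of_not_stuck hx m
      have hlength := length_consume_le rs l (r.2.2, m)
      rw [hr] at h
      dsimp only at hlength
      omega
    rw [consumeStep_of_stuck hx] at h
    exact List.forall_mem_cons.2 ⟨hx, ih (m := x :: m) (by rw [List.length_cons]; omega)⟩

theorem allStuck_pass {rs : List (Rule Pat)} {s : Name × List (QItem α)} (h : AllStuck rs s) :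
    AllStuck rs (pass rs s) := by
  have hpass : pass rs s = (s.1, s.2.reverse) := by
    rw [pass, consume_of_stuck h, List.append_nil]
  rw [hpass]
  exact fun x hx => h x (List.mem_reverse.1 hx)

theorem length_pass_lt {rs : List (Rule Pat)} {s : Name × List (QItem α)} (h : ¬ AllStuck rs s) :
    (pass rs s).2.length < s.2.length :=
  lt_of_not_ge fun hlength => h (stuck_of_length_consume (m := []) hlength)

theorem allStuck_iterate_pass (rs : List (Rule Pat)) {n : ℕ} {s : Name × List (QItem α)}
    (hn : s.2.length ≤ n) : AllStuck rs ((pass rs)^[n] s) := by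
  induction n generalizing s with
  | zero => exact fun x hx => absurd (List.length_pos_of_mem hx) (Nat.not_lt.2 hn)
  | succ n ih =>
    by_cases h : AllStuck rs s
    · exact Function.Iterate.rec (AllStuck rs) h (fun _ => allStuck_pass) _
    · exact ih (Nat.le_of_lt_succ ((length_pass_lt h).trans_le hn))

theorem allStuck_run (rs : List (Rule Pat)) (s : Name × List (QItem α)) : AllStuck rs (run rs s) :=
  allStuck_iterate_pass rs le_rfl

variable {H : HAut Pat}

theorem rew_consumeStep {x : QItem α} {s : Name × List (QItem α)} (h : ¬ Stuck H.ruleList s.1 x)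
    (l : List (QItem α)) :
    ∃ p', consumeStep (x, H.ruleList, s) = (p', s.2) ∧
      H.Rew (config (s.1, x :: l)) (config (p', l)) := by
  obtain ⟨r, hr, hp, hsat, hstep⟩ := consumeStep_of_not_stuck h s.2
  exact ⟨r.2.2, hstep, .read (items l) (show (s.1, r.2.1, r.2.2) ∈ H.rules from hp ▸ hr) hsat⟩

theorem rew_consume (l : List (QItem α)) (s : Name × List (QItem α)) :
    ReflTransGen H.Rew (config (s.1, l ++ s.2)) (config (consume H.ruleList l s)) := by
  induction l generalizing s with
  | nil => exact .refl
  | cons x l ih =>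
    by_cases h : Stuck H.ruleList s.1 x
    · have hperm : config (s.1, x :: l ++ s.2) = config (s.1, l ++ x :: s.2) :=
        config_congr List.perm_middle.symm s.1
      rw [consume_cons, consumeStep_of_stuck h, hperm]
      exact ih (s.1, x :: s.2)
    · obtain ⟨p', hstep, hrew⟩ := rew_consumeStep h (l ++ s.2)
      rw [consume_cons, hstep]
      exact .head hrew (ih (p', s.2))

theorem rew_pass (s : Name × List (QItem α)) :
    ReflTransGen H.Rew (config s) (config (pass H.ruleList s)) := by
  have h := rew_consume (H := H) s.2 (s.1, [])
  rwa [List.append_nil] at h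

theorem rew_run (s : Name × List (QItem α)) :
    ReflTransGen H.Rew (config s) (config (run H.ruleList s)) :=
  Function.Iterate.rec (fun s' => ReflTransGen H.Rew (config s) (config s')) .refl
    (fun s' h => h.trans (rew_pass s')) s.2.length

/-! ## Confluence -/

namespace HAut

theorem RewFail.eq_of_zero {p : HState} {c : Option (HState × Multiset (Item α))}
    (h : ReflTransGen H.RewFail (some (p, 0)) c) : c = some (p, 0) := by
  rcases h.cases_head with h | ⟨d, hd, -⟩
  · exact h.symm
  · generalize hzero : ((p, 0) : HState × Multiset (Item α)) = a at hd
    cases hd with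
    | step hd =>
      cases hd with
      | read => exact absurd (congrArg Prod.snd hzero) Multiset.zero_ne_cons
    | fail hne => exact absurd (congrArg Prod.snd hzero).symm hne

theorem RewFail.eq_of_none {c : Option (HState × Multiset (Item α))}
    (h : ReflTransGen H.RewFail none c) : c = none := by
  rcases h.cases_head with h | ⟨d, hd, -⟩
  · exact h.symm
  · cases hd

theorem RewFail.of_rew {a b : HState × Multiset (Item α)} (h : ReflTransGen H.Rew a b) :
    ReflTransGen H.RewFail (some a) (some b) := h.lift some fun _ _ => .step

theorem RewFail.of_allStuck {s : Name × List (QItem α)} (hne : s.2 ≠ [])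
    (h : AllStuck H.ruleList s) : H.RewFail (some (config s)) none := by
  refine .fail (fun hzero => hne (List.map_eq_nil_iff.1 (Multiset.coe_eq_zero _ |>.1 hzero))) ?_
  rintro ⟨c, hc⟩
  generalize hM : items s.2 = M at hc
  cases hc with
  | read M hr hsat =>
    obtain ⟨x, hx, rfl⟩ := List.mem_map.1 (Multiset.mem_coe.1 (hM ▸ Multiset.mem_cons_self _ M))
    exact h x hx _ hr rfl hsat

theorem Confluent.rew_iff_run (hH : H.Confluent) (p p' : Name) (l : List (QItem α)) :
    ReflTransGen H.Rew (config (p, l)) (config (p', [])) ↔ run H.ruleList (p, l) = (p', []) := by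
  have hrun := rew_run (H := H) (p, l)
  refine ⟨fun h => ?_, fun h => h ▸ hrun⟩
  have hstuck := allStuck_run H.ruleList (p, l)
  generalize run H.ruleList (p, l) = s at hrun hstuck ⊢
  obtain ⟨p₁, _ | ⟨x, m⟩⟩ := s
  · obtain ⟨d, hd, hd'⟩ := hH _ _ _ (RewFail.of_rew h) (RewFail.of_rew hrun)
    have heq := (RewFail.eq_of_zero hd').symm.trans (RewFail.eq_of_zero hd)
    have hstate : p₁ = p' := congrArg Prod.fst (Option.some.inj heq)
    rw [hstate]
  · have hfail := RewFail.of_allStuck (List.cons_ne_nil x m) hstuck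
    obtain ⟨d, hd, hd'⟩ := hH _ _ _ (RewFail.of_rew h) ((RewFail.of_rew hrun).tail hfail)
    exact absurd ((RewFail.eq_of_zero hd).symm.trans (RewFail.eq_of_none hd')) (by simp)

end HAut

/-! ## Correctness -/

theorem mem_of_target_eq_some {vs : List VRule} {p q : Name} (h : target (vs, p) = some q) :
    (p, q) ∈ vs := by
  obtain ⟨v, hfind, rfl⟩ := Option.map_eq_some_iff.1 h
  obtain rfl : v.1 = p := of_decide_eq_true (List.find?_some hfind :)
  exact List.mem_of_find?_eq_some hfind

theorem target_ne_none_of_mem {vs : List VRule} {p q : Name} (h : (p, q) ∈ vs) :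
    target (vs, p) ≠ none := fun hnone =>
  List.find?_eq_none.1 (Option.map_eq_none_iff.1 hnone) (p, q) h (decide_eq_true rfl)

theorem memName_eq_true_iff {l : List Name} {q : Name} : memName (l, q) = true ↔ q ∈ l := by
  simp [memName]

namespace AUTC

variable (C : AUTC Pat)

theorem mem_vrules (p' q : Name) :
    (p', q) ∈ C.params.2.2.2 ↔ ∃ h, (h, q) ∈ C.A.rules ∧ h.1.2.1 = p' := by
  refine List.mem_map.trans ⟨?_, ?_⟩
  · rintro ⟨⟨h, q'⟩, hr, heq⟩
    cases heq
    exact ⟨h, hr, rfl⟩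
  · rintro ⟨h, hr, rfl⟩
    exact ⟨_, hr, rfl⟩

theorem sat_iff_run (l : List (QItem α)) (h : (C.H.descriptorsFrom C.p₀).Desc) :
    (C.H.descriptorsFrom C.p₀).Sat (items l) h ↔
      run C.params.1 (C.params.2.1, l) = (h.1.2.1, []) := by
  obtain ⟨⟨p₀, p'⟩, rfl : p₀ = C.p₀⟩ := h
  exact C.confluent.rew_iff_run C.p₀.1 p'.1 l

theorem mem_targets_iff_run (l : List (QItem α)) (q : Name) :
    q ∈ C.A.targets (items l) ↔
      ∃ p', run C.params.1 (C.params.2.1, l) = (p', []) ∧ (p', q) ∈ C.params.2.2.2 := by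
  constructor
  · rintro ⟨h, hr, hsat⟩
    exact ⟨_, (C.sat_iff_run l h).1 hsat, (C.mem_vrules _ _).2 ⟨h, hr, rfl⟩⟩
  · rintro ⟨p', hrun, hv⟩
    obtain ⟨h, hr, rfl⟩ := (C.mem_vrules _ _).1 hv
    exact ⟨h, hr, (C.sat_iff_run l h).2 hrun⟩

theorem mem_targets_of_value {l : List (QItem α)} {q : Name} (h : value (C.params, l) = some q) :
    q ∈ C.A.targets (items l) := by
  rcases hrun : run C.params.1 (C.params.2.1, l) with ⟨p', _ | ⟨x, m⟩⟩
  · simp only [value, hrun] at h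
    exact (C.mem_targets_iff_run l q).2 ⟨p', hrun, mem_of_target_eq_some h⟩
  · simp only [value, hrun] at h
    cases h

theorem value_ne_none_of_mem_targets {l : List (QItem α)} {q : Name}
    (h : q ∈ C.A.targets (items l)) : value (C.params, l) ≠ none := by
  obtain ⟨p', hrun, hv⟩ := (C.mem_targets_iff_run l q).1 h
  simp only [value, hrun]
  exact target_ne_none_of_mem hv

theorem setOf_value_eq {l : List (QItem α)} (hl : (C.A.targets (items l)).Subsingleton) :
    {q | value (C.params, l) = some q} = C.A.targets (items l) := by
  refine Set.Subset.antisymm (fun q => C.mem_targets_of_value) fun q hq => ?_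
  obtain ⟨q', hq'⟩ := Option.ne_none_iff_exists'.1 (C.value_ne_none_of_mem_targets hq)
  exact hq'.trans (congrArg some (hl (C.mem_targets_of_value hq') hq))

/-- The list of items that is computed for a tree. -/
noncomputable def annotated : TreeTerm α → List (QItem α)
  | .empty => []
  | .add d t s => mkItem (d, value (C.params, annotated t)) :: annotated s

theorem items_annotated (t : TreeTerm α) : items (C.annotated t) = C.A.annotate t := by
  induction t with
  | empty => rfl
  | add d t s iht ihs =>
    have hvalue : {q | value (C.params, C.annotated t) = some q} =
        C.A.targets (C.A.annotate t) := by
      rw [← iht]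
      exact C.setOf_value_eq (iht ▸ C.deterministic t.toTree)
    rw [AUT.annotate, ← hvalue, ← ihs]
    rfl

theorem setOf_value_annotated (t : TreeTerm α) :
    {q | value (C.params, C.annotated t) = some q} = C.A.eval t.toTree := by
  have htargets : C.A.targets (items (C.annotated t)) = C.A.eval t.toTree := by
    rw [items_annotated]
    rfl
  rw [C.setOf_value_eq (htargets ▸ C.deterministic t.toTree), htargets]

theorem foldr_treeStep_encodeWord (d : List α) (s : Word α × List (List (QItem α))) :
    (encodeWord d).foldr (fun e s => treeStep (e, C.params, s)) s = (d, [] :: s.2) := by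
  induction d with
  | nil => rfl
  | cons a d ih =>
    change treeStep (.letter a, C.params,
      (encodeWord d).foldr (fun e s => treeStep (e, C.params, s)) s) = _
    rw [ih]
    rfl

theorem foldr_treeStep_encode (t : TreeTerm α) (s : Word α × List (List (QItem α))) :
    t.encode.foldr (fun e s => treeStep (e, C.params, s)) s =
      (Word.nil, C.annotated t :: s.2) := by
  induction t generalizing s with
  | empty => rfl
  | add d t r iht ihr =>
    rw [TreeTerm.encode, List.foldr_cons, List.foldr_append, List.foldr_append, ihr, iht,
      foldr_treeStep_encodeWord]
    rfl

theorem accepts_iff (t : TreeTerm α) :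
    accepts (C.params, t.encode) = true ↔ t.toTree ∈ C.language := by
  have hlanguage : t.toTree ∈ C.language ↔ ∃ q ∈ C.A.eval t.toTree, q ∈ C.A.final := Iff.rfl
  have hread : (readTree (C.params, t.encode)).2 = [C.annotated t] :=
    congrArg Prod.snd (C.foldr_treeStep_encode t _)
  rw [hlanguage, ← setOf_value_annotated]
  simp only [accepts, hread]
  cases value (C.params, C.annotated t) with
  | none => exact iff_of_false Bool.false_ne_true fun ⟨_, hq, _⟩ => Option.some_ne_none _ hq.symm
  | some q =>
    refine memName_eq_true_iff.trans ⟨fun h => ⟨q, rfl, h⟩, ?_⟩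
    rintro ⟨q', hq, hfinal⟩
    exact Option.some.inj hq ▸ hfinal

end AUTC

end Correctness

end UTA

theorem mainTheorem1 {α : Type} [Fintype α] (Pat : Set (UTA.Pattern α))
    (hfilters : UTA.InPTime (UTA.SingletonInstance.encode (Pat := Pat))
      UTA.SingletonInstance.Holds) :
    UTA.InPTime (UTA.MembershipInstance.encode (Pat := Pat)) UTA.MembershipInstance.Holds := by
  obtain ⟨h⟩ := hfilters
  let _ : Inhabited (UTA.Tok α) := ⟨.close⟩
  have holds_polyTime : UTA.PolyTime h.toTM2ComputableAux (UTA.Query.holds (Pat := Pat)) :=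
    UTA.PolyTime.oracle h.time UTA.SingletonInstance.encode (fun _ => rfl) h.outputsFun
  have accepts_polyTime := (UTA.PolyTime.accepts holds_polyTime).comp UTA.PolyTime.parse
  exact accepts_polyTime.inPTime (A := UTA.Source Pat)
    UTA.MembershipInstance.encode (fun _ => rfl) fun x => x.1.accepts_iff x.2
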